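/- An instance of Min $(s,t)$-Cut Prevention (MCP) consists of a finite simple undirected graph $G=(V,E)$, two distinct vertices $s,t\in V$, and integers $d$ and $a$. An $(s,t)$-cut is a set $A\subseteq E$ such that $G-A=(V,E\setminus A)$ contains no $(s,t)$-path. The question is whether there is a set $D\subseteq E$ with $|D|\le d$ such that every $(s,t)$-cut $A\subseteq E\setminus D$ satisfies $|A|>a$. Let $n=|V|$, and let $\mathrm{vc}(G)$ be the vertex cover number of $G$, that is, the smallest size of a set of vertices that meets every edge. Theorem. MCP can be solved in $2^{O(\mathrm{vc}(G)^2)}\cdot n^{O(1)}$ time. That is, there are a deterministic algorithm (a program of a unit-cost random access machine whose arithmetic operations are addition and subtraction of integers) and a constant $C$ such that, on every instance of MCP, given by $n$, $s$, $t$, $d$, $a$ and the adjacency matrix of $G$, the algorithm halts after at most $2^{C\cdot\mathrm{vc}(G)^2}\cdot n^{C}$ steps with the correct answer (yes or no). -/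

import Mathlib

/-! ### Random access machines, with a step count

A deterministic RAM with unit costs. It has registers and arrays, numbered by `ℕ` (a program names
only finitely many of them), which hold integers; array cells are addressed indirectly, through a
register. The arithmetic operations are addition and subtraction only. -/

namespace RAM

/-- The memory: `reg x` is the content of register `x`, and `arr u i` that of cell `i` of array
`u`. -/
structure Store where
  reg : ℕ → ℤ
  arr : ℕ → ℤ → ℤ

/-- Write the value `v` into register `x`. -/
def Store.setReg (σ : Store) (x : ℕ) (v : ℤ) : Store :=
  { σ with reg := Function.update σ.reg x v }

/-- Write the value `v` into cell `i` of array `u`. -/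
def Store.setArr (σ : Store) (u : ℕ) (i v : ℤ) : Store :=
  { σ with arr := Function.update σ.arr u (Function.update (σ.arr u) i v) }

/-- A test compares the contents of two registers. -/
inductive Test where
  | lt (x y : ℕ)
  | eq (x y : ℕ)

/-- The test succeeds in the given memory. -/
def Test.Holds : Test → Store → Prop
  | .lt x y, σ => σ.reg x < σ.reg y
  | .eq x y, σ => σ.reg x = σ.reg y

/-- Programs. -/
inductive Prog where
  /-- do nothing -/
  | skip
  /-- register `x` := the constant `c` -/
  | const (x : ℕ) (c : ℤ)
  /-- register `x` := register `y` -/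
  | copy (x y : ℕ)
  /-- register `x` := register `y` + register `z` -/
  | add (x y z : ℕ)
  /-- register `x` := register `y` - register `z` -/
  | sub (x y z : ℕ)
  /-- register `x` := the cell of array `u` whose address is in register `y` -/
  | load (x u y : ℕ)
  /-- the cell of array `u` whose address is in register `x` := register `y` -/
  | store (u x y : ℕ)
  | seq (p q : Prog)
  | ite (b : Test) (p q : Prog)
  | loop (b : Test) (p : Prog)

/-- `Exec p σ τ k`: started on the memory `σ`, the program `p` halts after exactly `k` steps, with
memory `τ`. Every elementary instruction and every evaluation of a test is one step. A program that
does not halt on `σ` has no such `τ` and `k`. -/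
inductive Exec : Prog → Store → Store → ℕ → Prop where
  | skip (σ : Store) : Exec .skip σ σ 1
  | const (x : ℕ) (c : ℤ) (σ : Store) : Exec (.const x c) σ (σ.setReg x c) 1
  | copy (x y : ℕ) (σ : Store) : Exec (.copy x y) σ (σ.setReg x (σ.reg y)) 1
  | add (x y z : ℕ) (σ : Store) : Exec (.add x y z) σ (σ.setReg x (σ.reg y + σ.reg z)) 1
  | sub (x y z : ℕ) (σ : Store) : Exec (.sub x y z) σ (σ.setReg x (σ.reg y - σ.reg z)) 1
  | load (x u y : ℕ) (σ : Store) : Exec (.load x u y) σ (σ.setReg x (σ.arr u (σ.reg y))) 1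
  | store (u x y : ℕ) (σ : Store) : Exec (.store u x y) σ (σ.setArr u (σ.reg x) (σ.reg y)) 1
  | seq {p q : Prog} {σ τ ρ : Store} {k l : ℕ} (hp : Exec p σ τ k) (hq : Exec q τ ρ l) :
      Exec (.seq p q) σ ρ (k + l)
  | iteTrue {b : Test} {p q : Prog} {σ τ : Store} {k : ℕ} (hb : b.Holds σ) (hp : Exec p σ τ k) :
      Exec (.ite b p q) σ τ (k + 1)
  | iteFalse {b : Test} {p q : Prog} {σ τ : Store} {k : ℕ} (hb : ¬ b.Holds σ)
      (hq : Exec q σ τ k) : Exec (.ite b p q) σ τ (k + 1)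
  | loopFalse {b : Test} {p : Prog} {σ : Store} (hb : ¬ b.Holds σ) : Exec (.loop b p) σ σ 1
  | loopTrue {b : Test} {p : Prog} {σ τ ρ : Store} {k l : ℕ} (hb : b.Holds σ)
      (hp : Exec p σ τ k) (hl : Exec (.loop b p) τ ρ l) : Exec (.loop b p) σ ρ (k + l + 1)

/-- The machine is deterministic: the final memory and the number of steps are determined by the
program and the initial memory. -/
theorem Exec.deterministic {p : Prog} {σ τ τ' : Store} {k k' : ℕ}
    (h : Exec p σ τ k) (h' : Exec p σ τ' k') : τ = τ' ∧ k = k' := by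
  induction h generalizing τ' k' with
  | seq _ _ ihp ihq =>
    cases h' with
    | seq hp' hq' =>
      obtain ⟨rfl, rfl⟩ := ihp hp'
      obtain ⟨rfl, rfl⟩ := ihq hq'
      exact ⟨rfl, rfl⟩
  | iteTrue hb _ ih =>
    cases h' with
    | iteTrue _ hp' =>
      obtain ⟨rfl, rfl⟩ := ih hp'
      exact ⟨rfl, rfl⟩
    | iteFalse hb' _ => exact absurd hb hb'
  | iteFalse hb _ ih =>
    cases h' with
    | iteTrue hb' _ => exact absurd hb' hb
    | iteFalse _ hq' =>
      obtain ⟨rfl, rfl⟩ := ih hq'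
      exact ⟨rfl, rfl⟩
  | loopFalse hb =>
    cases h' with
    | loopFalse _ => exact ⟨rfl, rfl⟩
    | loopTrue hb' _ _ => exact absurd hb' hb
  | loopTrue hb _ _ ihp ihl =>
    cases h' with
    | loopFalse hb' => exact absurd hb hb'
    | loopTrue _ hp' hl' =>
      obtain ⟨rfl, rfl⟩ := ihp hp'
      obtain ⟨rfl, rfl⟩ := ihl hl'
      exact ⟨rfl, rfl⟩
  | _ => cases h'; exact ⟨rfl, rfl⟩

end RAM

/-! ### Min (s,t)-Cut Prevention -/

namespace MCP

/-- `A` is an `(s,t)`-cut of `G`: a set of edges of `G` such that `G - A` has no `(s,t)`-path. -/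
def IsCut {V : Type*} (G : SimpleGraph V) (s t : V) (A : Finset (Sym2 V)) : Prop :=
  (A : Set (Sym2 V)) ⊆ G.edgeSet ∧ IsEmpty ((G.deleteEdges (A : Set (Sym2 V))).Path s t)

/-- An instance: a graph with vertices `0, …, n - 1`, two distinct vertices `s` and `t`, the budget
`d` of the defender and the budget `a` of the attacker. -/
structure Instance where
  n : ℕ
  G : SimpleGraph (Fin n)
  s : Fin n
  t : Fin n
  s_ne_t : s ≠ t
  d : ℤ
  a : ℤ

/-- The instance is a yes-instance: there is a set `D` of at most `d` edges such that every
`(s,t)`-cut that is disjoint from `D` has more than `a` edges. -/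
def Instance.IsYes (I : Instance) : Prop :=
  ∃ D : Finset (Sym2 (Fin I.n)), (D : Set (Sym2 (Fin I.n))) ⊆ I.G.edgeSet ∧ (D.card : ℤ) ≤ I.d ∧
    ∀ A : Finset (Sym2 (Fin I.n)), IsCut I.G I.s I.t A → Disjoint A D → I.a < (A.card : ℤ)

/-- The vertex cover number of the graph. -/
noncomputable def Instance.vc (I : Instance) : ℕ :=
  I.G.vertexCoverNum.toNat

open Classical in
/-- The memory that holds the input: `n`, `s`, `t`, `d`, `a` in registers `0`, …, `4`, the adjacency
matrix of the graph row by row in the cells `0`, …, `n * n - 1` of array `0`, and `0` everywhere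
else. -/
noncomputable def Instance.input (I : Instance) : RAM.Store where
  reg x := match x with
    | 0 => (I.n : ℤ)
    | 1 => ((I.s : ℕ) : ℤ)
    | 2 => ((I.t : ℕ) : ℤ)
    | 3 => I.d
    | 4 => I.a
    | _ => 0
  arr u k := if u = 0 ∧ ∃ i j : Fin I.n, I.G.Adj i j ∧ k = ((i : ℕ) : ℤ) * I.n + ((j : ℕ) : ℤ)
    then 1 else 0

end MCP

/-! ### Running times of programs -/

namespace RAM

-- The program is a brute-force search, kept small by a vertex cover `X` that contains `s` and `t`.
-- The endpoints of a greedy maximal matching, together with `s` and `t`, form such a cover with at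
-- most `2 * vc + 2` elements (`cover_runs`). Negative budgets are trivial; suppose that both are
-- nonnegative.
--
-- The budget. A path cannot visit two vertices outside `X` in a row, so an `(s,t)`-path has fewer
-- than `2 * |X|` edges (`length_lt_of_isPath`). If `d ≥ 2 * |X|`, a whole path can be defended and
-- the answer is mere reachability (`exists_resists_iff_reachable`), which is also the answer for
-- both budgets equal to `0`. Hence `d < 2 * |X|` may be assumed, or `d = a = 0`.
--
-- The candidates. Exchanging two twins is an automorphism. A defense touches at most `2 * d`
-- vertices, so if it touches a vertex other than `s` and `t` with `2 * d + 2` smaller twins, one of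
-- these is untouched and differs from `s` and `t`; the exchange moves the defense to smaller
-- indices. So only vertices of `X` and vertices with fewer than `2 * d + 2` smaller twins are
-- needed (`exists_touched_subset`). Outside `X` a neighborhood is a subset of `X`, so at most `|X|
-- + 2 ^ |X| * (2 * d + 2)` vertices are kept (`card_kept_le`), and there are only `2 ^ O(|X| ^ 2)`
-- sequences of `2 * d` of them (`card_bounds`).
--
-- The test of one defense. Give weight `a + 1` to defended edges and `1` to the others. The defense
-- works iff every bipartition that separates `s` from `t` has weight more than `a`
-- (`MCP.resists_iff`). Once the sides on `X` are fixed, the other vertices, being independent,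
-- choose their cheaper sides separately, so `2 ^ |X|` assignments suffice (`safe_iff`).
--
-- Both enumerations are counters read as mixed radix numerals (`exists_digit_eq`). Products and
-- quotients are obtained by repeated addition and subtraction; the operands are small enough for
-- the total to stay polynomial in `n` and `2 ^ O(vc ^ 2)`.

infixr:50 " ;; " => Prog.seq

@[simp] theorem Store.reg_setReg (σ : Store) (x y : ℕ) (v : ℤ) :
    (σ.setReg x v).reg y = if y = x then v else σ.reg y := by
  simp [Store.setReg, Function.update_apply]

@[simp] theorem Store.arr_setReg (σ : Store) (x : ℕ) (v : ℤ) : (σ.setReg x v).arr = σ.arr := rfl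

@[simp] theorem Store.reg_setArr (σ : Store) (u : ℕ) (i v : ℤ) : (σ.setArr u i v).reg = σ.reg := rfl

@[simp] theorem Store.arr_setArr (σ : Store) (u w : ℕ) (i v : ℤ) :
    (σ.setArr u i v).arr w = if w = u then Function.update (σ.arr u) i v else σ.arr w := by
  simp [Store.setArr, Function.update_apply]

/-- The registers that a program may write. -/
def Prog.wr : Prog → ℕ → Bool
  | .skip, _ => false
  | .const x _, y => y == x
  | .copy x _, y => y == x
  | .add x _ _, y => y == x
  | .sub x _ _, y => y == x
  | .load x _ _, y => y == x
  | .store _ _ _, _ => false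
  | .seq p q, y => p.wr y || q.wr y
  | .ite _ p q, y => p.wr y || q.wr y
  | .loop _ p, y => p.wr y

/-- The arrays that a program may write. -/
def Prog.wa : Prog → ℕ → Bool
  | .store u _ _, w => w == u
  | .seq p q, w => p.wa w || q.wa w
  | .ite _ p q, w => p.wa w || q.wa w
  | .loop _ p, w => p.wa w
  | _, _ => false

/-- The memories agree on everything that `p` cannot write. -/
def Same (p : Prog) (σ τ : Store) : Prop :=
  (∀ x, p.wr x = false → τ.reg x = σ.reg x) ∧ ∀ u, p.wa u = false → τ.arr u = σ.arr u

theorem Same.refl (p : Prog) (σ : Store) : Same p σ σ := ⟨fun _ _ => rfl, fun _ _ => rfl⟩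

theorem Same.trans {p : Prog} {σ τ ρ : Store} (h : Same p σ τ) (h' : Same p τ ρ) : Same p σ ρ :=
  ⟨fun x hx => (h'.1 x hx).trans (h.1 x hx), fun u hu => (h'.2 u hu).trans (h.2 u hu)⟩

theorem Same.mono {p q : Prog} {σ τ : Store} (h : Same p σ τ)
    (hr : ∀ x, q.wr x = false → p.wr x = false) (ha : ∀ u, q.wa u = false → p.wa u = false) :
    Same q σ τ :=
  ⟨fun x hx => h.1 x (hr x hx), fun u hu => h.2 u (ha u hu)⟩

/-- This is the frame rule. Since `wr` and `wa` are computable, its side conditions for concrete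
programs are closed by `rfl`. -/
theorem Exec.same {p : Prog} {σ τ : Store} {k : ℕ} (h : Exec p σ τ k) : Same p σ τ := by
  induction h with
  | skip => exact Same.refl _ _
  | const x c σ | copy x y σ | add x y z σ | sub x y z σ | load x u y σ =>
    refine ⟨fun w hw => ?_, fun _ _ => rfl⟩
    have : w ≠ x := by simpa [Prog.wr] using hw
    simp [this]
  | store u x y σ =>
    refine ⟨fun _ _ => rfl, fun w hw => ?_⟩
    have : w ≠ u := by simpa [Prog.wa] using hw
    simp [this]
  | seq _ _ ihp ihq =>
    exact (ihp.mono (fun x hx => by simp_all [Prog.wr]) (fun x hx => by simp_all [Prog.wa])).trans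
      (ihq.mono (fun x hx => by simp_all [Prog.wr]) (fun x hx => by simp_all [Prog.wa]))
  | iteTrue _ _ ih | iteFalse _ _ ih =>
    exact ih.mono (fun x hx => by simp_all [Prog.wr]) (fun x hx => by simp_all [Prog.wa])
  | loopFalse => exact Same.refl _ _
  | loopTrue _ _ _ ihp ihl =>
    exact (ihp.mono (fun x hx => by simpa [Prog.wr] using hx)
      (fun x hx => by simpa [Prog.wa] using hx)).trans ihl

/-- Started on `σ`, the program `p` halts within `T` steps, in a memory that satisfies `Q`. -/
def Runs (p : Prog) (σ : Store) (T : ℕ) (Q : Store → Prop) : Prop :=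
  ∃ τ k, Exec p σ τ k ∧ k ≤ T ∧ Q τ

theorem Runs.mono {p : Prog} {σ : Store} {T T' : ℕ} {Q Q' : Store → Prop} (h : Runs p σ T Q)
    (hT : T ≤ T') (hQ : ∀ τ, Same p σ τ → Q τ → Q' τ) : Runs p σ T' Q' := by
  obtain ⟨τ, k, he, hk, hq⟩ := h
  exact ⟨τ, k, he, hk.trans hT, hQ τ he.same hq⟩

theorem Runs.le {p : Prog} {σ : Store} {T T' : ℕ} {Q : Store → Prop} (h : Runs p σ T Q)
    (hT : T ≤ T') : Runs p σ T' Q := h.mono hT fun _ _ hq => hq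

theorem Runs.seq {p q : Prog} {σ : Store} {T T' : ℕ} {R Q : Store → Prop} (hp : Runs p σ T R)
    (hq : ∀ τ, Same p σ τ → R τ → Runs q τ T' Q) : Runs (p ;; q) σ (T + T') Q := by
  obtain ⟨τ, k, he, hk, hr⟩ := hp
  obtain ⟨ρ, l, he', hl, hQ⟩ := hq τ he.same hr
  exact ⟨ρ, k + l, he.seq he', by omega, hQ⟩

theorem Runs.ite {b : Test} {p q : Prog} {σ : Store} {T T' : ℕ} {Q : Store → Prop}
    (hp : b.Holds σ → Runs p σ T Q) (hq : ¬ b.Holds σ → Runs q σ T' Q) :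
    Runs (.ite b p q) σ (T + T' + 1) Q := by
  by_cases hb : b.Holds σ
  · obtain ⟨τ, k, he, hk, hQ⟩ := hp hb
    exact ⟨τ, k + 1, .iteTrue hb he, by omega, hQ⟩
  · obtain ⟨τ, k, he, hk, hQ⟩ := hq hb
    exact ⟨τ, k + 1, .iteFalse hb he, by omega, hQ⟩

instance (b : Test) (σ : Store) : Decidable (b.Holds σ) := by
  cases b <;> unfold Test.Holds <;> infer_instance

/-- The effect of a program without loops. -/
def Prog.run : Prog → Store → Store
  | .skip, σ => σ
  | .const x c, σ => σ.setReg x c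
  | .copy x y, σ => σ.setReg x (σ.reg y)
  | .add x y z, σ => σ.setReg x (σ.reg y + σ.reg z)
  | .sub x y z, σ => σ.setReg x (σ.reg y - σ.reg z)
  | .load x u y, σ => σ.setReg x (σ.arr u (σ.reg y))
  | .store u x y, σ => σ.setArr u (σ.reg x) (σ.reg y)
  | .seq p q, σ => q.run (p.run σ)
  | .ite b p q, σ => if b.Holds σ then p.run σ else q.run σ
  | .loop _ _, σ => σ

/-- The program has no loops. -/
def Prog.flat : Prog → Bool
  | .seq p q => p.flat && q.flat
  | .ite _ p q => p.flat && q.flat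
  | .loop _ _ => false
  | _ => true

/-- A bound for the number of steps of a program without loops. -/
def Prog.size : Prog → ℕ
  | .seq p q => p.size + q.size
  | .ite _ p q => p.size + q.size + 1
  | _ => 1

theorem Prog.exec_run {p : Prog} (hp : p.flat = true) (σ : Store) :
    ∃ k ≤ p.size, Exec p σ (p.run σ) k := by
  induction p generalizing σ with
  | skip => exact ⟨1, le_rfl, .skip σ⟩
  | const => exact ⟨1, le_rfl, .const _ _ σ⟩
  | copy => exact ⟨1, le_rfl, .copy _ _ σ⟩
  | add => exact ⟨1, le_rfl, .add _ _ _ σ⟩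
  | sub => exact ⟨1, le_rfl, .sub _ _ _ σ⟩
  | load => exact ⟨1, le_rfl, .load _ _ _ σ⟩
  | store => exact ⟨1, le_rfl, .store _ _ _ σ⟩
  | seq p q ihp ihq =>
    simp only [Prog.flat, Bool.and_eq_true] at hp
    obtain ⟨k, hk, h⟩ := ihp hp.1 σ
    obtain ⟨l, hl, h'⟩ := ihq hp.2 (p.run σ)
    exact ⟨k + l, by simp only [Prog.size]; omega, h.seq h'⟩
  | ite b p q ihp ihq =>
    simp only [Prog.flat, Bool.and_eq_true] at hp
    obtain ⟨k, hk, h⟩ := ihp hp.1 σ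
    obtain ⟨l, hl, h'⟩ := ihq hp.2 σ
    by_cases hb : b.Holds σ
    · exact ⟨k + 1, by simp only [Prog.size]; omega, by
        simpa [Prog.run, hb] using Exec.iteTrue (q := q) hb h⟩
    · exact ⟨l + 1, by simp only [Prog.size]; omega, by
        simpa [Prog.run, hb] using Exec.iteFalse (p := p) hb h'⟩
  | loop => simp [Prog.flat] at hp

/-- Straight-line code is verified by evaluating `Prog.run` with `simp`; no intermediate assertions
are needed. -/
theorem Runs.flat {p : Prog} {σ : Store} {Q : Store → Prop} (hp : p.flat = true)
    (hQ : Q (p.run σ)) : Runs p σ p.size Q := by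
  obtain ⟨k, hk, h⟩ := Prog.exec_run hp σ
  exact ⟨_, k, h, hk, hQ⟩

/-- A loop with counter `i`, from `0` to the content of register `N`; register `5` holds `1`. -/
def forLoop (i N : ℕ) (p : Prog) : Prog :=
  .const i 0 ;; .loop (.lt i N) (p ;; .add i i 5)

/-- The invariant is required of the memory after the counter has been incremented. Each round pays
for its test and its increment; the final `+ 2` pays for the initialization and the failing test. -/
theorem Runs.forLoop {i N : ℕ} {p : Prog} {σ : Store} {T n : ℕ} {Q : Store → Prop}
    (Inv : ℕ → Store → Prop)
    (hw : (p.wr i || p.wr N || p.wr 5 || (N == i) || (5 == i)) = false)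
    (hN : σ.reg N = n) (h5 : σ.reg 5 = 1) (h0 : Inv 0 (σ.setReg i 0))
    (hs : ∀ j < n, ∀ τ, Same (RAM.forLoop i N p) σ τ → τ.reg i = j → Inv j τ →
      Runs p τ T fun ρ => Inv (j + 1) (ρ.setReg i ((j + 1 : ℕ) : ℤ)))
    (hQ : ∀ τ, Same (RAM.forLoop i N p) σ τ → Inv n τ → Q τ) :
    Runs (RAM.forLoop i N p) σ (n * (T + 2) + 2) Q := by
  simp only [Bool.or_eq_false_iff, beq_eq_false_iff_ne] at hw
  obtain ⟨⟨⟨⟨hwi, hwN⟩, hw5⟩, hNi⟩, h5i⟩ := hw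
  have key : ∀ m j, j + m = n → ∀ τ, Same (RAM.forLoop i N p) σ τ → τ.reg i = j → Inv j τ →
      Runs (.loop (.lt i N) (p ;; .add i i 5)) τ (m * (T + 2) + 1) Q := by
    intro m
    induction m with
    | zero =>
      intro j hj τ hf hi hI
      have hNτ : τ.reg N = n := (hf.1 N (by simp [RAM.forLoop, Prog.wr, hwN, hNi])).trans hN
      refine ⟨τ, 1, .loopFalse ?_, by omega, hQ τ hf ?_⟩
      · simp only [Test.Holds]; omega
      · rwa [← hj]
    | succ m ih =>
      intro j hj τ hf hi hI
      have hNτ : τ.reg N = n := (hf.1 N (by simp [RAM.forLoop, Prog.wr, hwN, hNi])).trans hN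
      have h5τ : τ.reg 5 = 1 := (hf.1 5 (by simp [RAM.forLoop, Prog.wr, hw5, h5i])).trans h5
      obtain ⟨ρ, k, he, hk, hρ⟩ := hs j (by omega) τ hf hi hI
      have hiρ : ρ.reg i = j := (he.same.1 i hwi).trans hi
      have h5ρ : ρ.reg 5 = 1 := (he.same.1 5 hw5).trans h5τ
      have he' := he.seq (Exec.add i i 5 ρ)
      have hsm := he'.same
      rw [show ρ.reg i + ρ.reg 5 = ((j + 1 : ℕ) : ℤ) by rw [hiρ, h5ρ]; push_cast; rfl] at he' hsm
      obtain ⟨τ', l, hl, hlT, hq⟩ := ih (j + 1) (by omega) _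
        (hf.trans (hsm.mono (fun x hx => by simp_all [RAM.forLoop, Prog.wr])
          (fun x hx => by simp_all [RAM.forLoop, Prog.wa]))) (by simp) hρ
      refine ⟨τ', _, .loopTrue ?_ he' hl, ?_, hq⟩
      · simp only [Test.Holds]; omega
      · rw [Nat.succ_mul]; omega
  obtain ⟨τ, k, he, hk, hq⟩ := key n 0 (by omega) (σ.setReg i 0)
    ((Exec.const i 0 σ).same.mono (fun x hx => by simp_all [RAM.forLoop, Prog.wr])
      (fun x hx => by simp_all [Prog.wa])) (by simp) h0
  exact ⟨τ, 1 + k, .seq (.const i 0 σ) he, by omega, hq⟩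

/-! ### The multiplication table -/

/-- Cell `i` of array `1` becomes `i * n`, and register `10` becomes `n * n`. -/
def mulTable : Prog :=
  .const 10 0 ;; forLoop 11 0 (.store 1 11 10 ;; .add 10 10 0)

/-- The machine cannot multiply, so the row offsets of the matrices are tabulated once by repeated
addition. -/
theorem mulTable_runs {σ : Store} {n : ℕ} (hn : σ.reg 0 = n) (h5 : σ.reg 5 = 1) :
    Runs mulTable σ (4 * n + 3) fun τ =>
      τ.reg 10 = n * n ∧ ∀ i : ℕ, i < n → τ.arr 1 i = i * n := by
  refine ((Runs.flat rfl (Q := fun τ => τ.reg 10 = 0) (by simp [Prog.run])).seq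
    fun τ hτ h10 => Runs.forLoop (n := n) (T := 2)
      (fun j τ => τ.reg 10 = j * n ∧ ∀ i : ℕ, i < j → τ.arr 1 i = i * n) rfl
      ((hτ.1 0 rfl).trans hn) ((hτ.1 5 rfl).trans h5) (by simp [h10]) ?_
      (fun _ _ h => h)).le (by simp only [Prog.size]; omega)
  intro j hj ρ hρ h11 ⟨h, h'⟩
  refine Runs.flat rfl ?_
  have h0 : ρ.reg 0 = n := (hρ.1 0 rfl).trans ((hτ.1 0 rfl).trans hn)
  simp only [Prog.run]
  refine ⟨by simp [h, h0]; ring, fun i hi => ?_⟩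
  rcases Nat.lt_succ_iff_lt_or_eq.1 hi with hi | rfl
  · simp [h11, h' i hi, hi.ne]
  · simp [h11, h]

end RAM

namespace RAM

/-! ### A greedy vertex cover -/

/-- The array `f` holds the indicator function of `X`. -/
def Represents (f : ℤ → ℤ) (X : Finset ℕ) : Prop := ∀ v : ℕ, f v = if v ∈ X then 1 else 0

theorem Represents.update {f : ℤ → ℤ} {X : Finset ℕ} (h : Represents f X) (w : ℕ) :
    Represents (Function.update f w 1) (insert w X) := by
  intro v
  by_cases hv : v = w
  · simp [hv]
  · simp [hv, h v]

/-- The array `f` holds, row by row, the adjacency matrix of `E` on `0, …, n - 1`. -/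
def Adjacency (f : ℤ → ℤ) (n : ℕ) (E : ℕ → ℕ → Prop) : Prop :=
  ∀ u < n, ∀ v < n, (f (u * n + v) = 1 ∧ E u v) ∨ (f (u * n + v) = 0 ∧ ¬ E u v)

/-- The set `C` meets every edge of `E` on `0, …, n - 1`. -/
def Covers (C : Finset ℕ) (n : ℕ) (E : ℕ → ℕ → Prop) : Prop :=
  ∀ u < n, ∀ v < n, E u v → u ∈ C ∨ v ∈ C

/-- The set `X` has at most two elements for each element of a vertex cover. -/
def Economical (X : Finset ℕ) (n : ℕ) (E : ℕ → ℕ → Prop) : Prop :=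
  X ⊆ Finset.range n ∧ ∀ C, Covers C n E → X.card ≤ 2 * (X ∩ C).card

/-- Every cover `C` contains an endpoint of the edge, and that endpoint is not in `X`: the left side
grows by at most `2` and `X ∩ C` by at least `1`. Counting `X ∩ C` rather than `C` is what makes the
induction work. -/
theorem Economical.insert_edge {X : Finset ℕ} {n : ℕ} {E : ℕ → ℕ → Prop} (h : Economical X n E)
    {u v : ℕ} (hu : u < n) (hv : v < n) (huv : E u v) (huX : u ∉ X) (hvX : v ∉ X) :
    Economical (insert v (insert u X)) n E := by
  refine ⟨?_, fun C hC => ?_⟩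
  · intro w hw
    simp only [Finset.mem_insert] at hw
    rcases hw with rfl | rfl | hw
    · simpa
    · simpa
    · exact h.1 hw
  · have h1 := h.2 C hC
    have h2 : (insert v (insert u X)).card ≤ X.card + 2 :=
      (Finset.card_insert_le _ _).trans (Nat.succ_le_succ (Finset.card_insert_le _ _))
    have h3 : (X ∩ C).card + 1 ≤ (insert v (insert u X) ∩ C).card := by
      rcases hC u hu v hv huv with hc | hc
      · rw [← Finset.card_insert_of_notMem (a := u) (s := X ∩ C) (by simp [huX])]
        refine Finset.card_le_card fun w hw => ?_
        simp only [Finset.mem_insert, Finset.mem_inter] at hw ⊢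
        rcases hw with rfl | hw <;> tauto
      · rw [← Finset.card_insert_of_notMem (a := v) (s := X ∩ C) (by simp [hvX])]
        refine Finset.card_le_card fun w hw => ?_
        simp only [Finset.mem_insert, Finset.mem_inter] at hw ⊢
        rcases hw with rfl | hw <;> tauto
    omega

/-- The pair of vertices in the registers `12` and `13` enters the cover if it is an uncovered
edge. -/
def coverStep : Prog :=
  .add 15 14 13 ;; .load 15 0 15 ;; .load 16 2 12 ;; .load 17 2 13 ;; .add 16 16 17 ;;
  .ite (.eq 15 5) (.ite (.eq 16 6) (.store 2 12 5 ;; .store 2 13 5) .skip) .skip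

/-- Array `2` becomes the indicator function of a vertex cover that contains the vertices in the
registers `1` and `2`. -/
def cover : Prog :=
  forLoop 12 0 (.load 14 1 12 ;; forLoop 13 0 coverStep) ;; .store 2 1 5 ;; .store 2 2 5

theorem coverStep_runs {σ : Store} {n u v : ℕ} {E : ℕ → ℕ → Prop} {X : Finset ℕ}
    (h5 : σ.reg 5 = 1) (h6 : σ.reg 6 = 0) (h12 : σ.reg 12 = u) (h13 : σ.reg 13 = v)
    (h14 : σ.reg 14 = u * n) (hE : Adjacency (σ.arr 0) n E) (hX : Represents (σ.arr 2) X)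
    (hXe : Economical X n E) (hu : u < n) (hv : v < n) :
    Runs coverStep σ 11 fun τ => ∃ Y, X ⊆ Y ∧ Represents (τ.arr 2) Y ∧ Economical Y n E ∧
      (E u v → u ∈ Y ∨ v ∈ Y) := by
  refine Runs.flat (p := coverStep) rfl ?_
  by_cases huX : u ∈ X
  · refine ⟨X, subset_rfl, ?_, hXe, fun _ => .inl huX⟩
    have h1 := hX u
    have h2 := hX v
    rcases hE u hu v hv with ⟨h, h'⟩ | ⟨h, h'⟩ <;>
    by_cases hvX : v ∈ X <;> simp_all [coverStep, Prog.run, Test.Holds]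
  by_cases hvX : v ∈ X
  · refine ⟨X, subset_rfl, ?_, hXe, fun _ => .inr hvX⟩
    have h1 := hX u
    have h2 := hX v
    rcases hE u hu v hv with ⟨h, h'⟩ | ⟨h, h'⟩ <;> simp_all [coverStep, Prog.run, Test.Holds]
  have h1 : σ.arr 2 u = 0 := by simpa [huX] using hX u
  have h2 : σ.arr 2 v = 0 := by simpa [hvX] using hX v
  rcases hE u hu v hv with ⟨h, h'⟩ | ⟨h, h'⟩
  · refine ⟨insert v (insert u X), ?_, ?_, hXe.insert_edge hu hv h' huX hvX, fun _ => by simp⟩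
    · exact (Finset.subset_insert _ _).trans (Finset.subset_insert _ _)
    · have := (hX.update u).update v
      simpa [coverStep, Prog.run, Test.Holds, h1, h2, h5, h6, h12, h13, h14, h] using this
  · exact ⟨X, subset_rfl, by
      simpa [coverStep, Prog.run, Test.Holds, h1, h2, h5, h6, h12, h13, h14, h] using hX, hXe,
      fun h => absurd h h'⟩

/-- The greedy phase yields a `2`-approximation; the additive `2` is the price of adding `s` and `t`
afterwards. -/
theorem cover_runs {σ : Store} {n s t : ℕ} {E : ℕ → ℕ → Prop}
    (h0 : σ.reg 0 = n) (h1 : σ.reg 1 = s) (h2 : σ.reg 2 = t) (h5 : σ.reg 5 = 1)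
    (h6 : σ.reg 6 = 0) (hM : ∀ i : ℕ, i < n → σ.arr 1 i = i * n)
    (hE : Adjacency (σ.arr 0) n E) (hX : Represents (σ.arr 2) ∅) (hs : s < n) (ht : t < n) :
    Runs cover σ (n * (13 * n + 5) + 4) fun τ => ∃ X, Represents (τ.arr 2) X ∧
      X ⊆ Finset.range n ∧ Covers X n E ∧ s ∈ X ∧ t ∈ X ∧
      ∀ C, Covers C n E → X.card ≤ 2 * C.card + 2 := by
  refine ((Runs.forLoop (n := n) (T := 1 + (n * 13 + 2)) (Q := fun τ => ∃ X,
      Represents (τ.arr 2) X ∧ Economical X n E ∧ ∀ u < n, ∀ v < n, E u v → u ∈ X ∨ v ∈ X)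
    (fun j τ => ∃ X, Represents (τ.arr 2) X ∧ Economical X n E ∧
      ∀ u < j, ∀ v < n, E u v → u ∈ X ∨ v ∈ X) rfl h0 h5
      ⟨∅, by simpa using hX, by simp [Economical], by simp⟩ ?_ (fun _ _ h => h)).seq
    (T' := 2) ?_).le ?_
  · rintro u hu τ hτ h12 ⟨X, hX, hXe, hXc⟩
    refine (Runs.flat (p := .load 14 1 12) rfl
      (Q := fun ρ => ρ.reg 14 = u * n) (by
        have : τ.arr 1 = σ.arr 1 := hτ.2 1 rfl
        simp [Prog.run, h12, this, hM u hu])).seq fun ρ hρ h14 => ?_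
    refine Runs.forLoop (n := n) (T := 11) (fun v ρ' => ∃ Y, X ⊆ Y ∧ Represents (ρ'.arr 2) Y ∧
      Economical Y n E ∧ ∀ v' < v, E u v' → u ∈ Y ∨ v' ∈ Y) rfl
      ((hρ.1 0 rfl).trans ((hτ.1 0 rfl).trans h0)) ((hρ.1 5 rfl).trans ((hτ.1 5 rfl).trans h5))
      ⟨X, subset_rfl, by rw [← hρ.2 2 rfl] at hX; simpa using hX, hXe, by simp⟩ ?_ ?_
    · rintro v hv τ' hτ' h13 ⟨Y, hXY, hY, hYe, hYc⟩
      refine (coverStep_runs (n := n) (E := E) (X := Y) (u := u) (v := v) ?_ ?_ ?_ h13 ?_ ?_ hY hYe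
        hu hv).mono le_rfl ?_
      · rw [hτ'.1 5 rfl, hρ.1 5 rfl, hτ.1 5 rfl, h5]
      · rw [hτ'.1 6 rfl, hρ.1 6 rfl, hτ.1 6 rfl, h6]
      · rw [hτ'.1 12 rfl, hρ.1 12 rfl, h12]
      · rw [hτ'.1 14 rfl, h14]
      · rw [hτ'.2 0 rfl, hρ.2 0 rfl, hτ.2 0 rfl]; exact hE
      · rintro τ'' - ⟨Z, hYZ, hZ, hZe, hZc⟩
        refine ⟨Z, hXY.trans hYZ, by simpa using hZ, hZe, fun v' hv' h => ?_⟩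
        rcases Nat.lt_succ_iff_lt_or_eq.1 hv' with hv' | rfl
        · exact (hYc v' hv' h).imp (fun h => hYZ h) fun h => hYZ h
        · exact hZc h
    · rintro τ' - ⟨Y, hXY, hY, hYe, hYc⟩
      refine ⟨Y, by simpa using hY, hYe, fun u' hu' v hv h => ?_⟩
      rcases Nat.lt_succ_iff_lt_or_eq.1 hu' with hu' | rfl
      · exact (hXc u' hu' v hv h).imp (fun h => hXY h) fun h => hXY h
      · exact hYc v hv h
  · rintro τ hτ ⟨X, hX, hXe, hXc⟩
    refine Runs.flat (p := .store 2 1 5 ;; .store 2 2 5) rfl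
      ⟨insert t (insert s X), ?_, ?_, ?_, by simp, by simp, fun C hC => ?_⟩
    · have := (hX.update s).update t
      simpa [Prog.run, hτ.1 1 rfl, hτ.1 2 rfl, hτ.1 5 rfl, h1, h2, h5] using this
    · intro w hw
      simp only [Finset.mem_insert] at hw
      rcases hw with rfl | rfl | hw
      · simpa
      · simpa
      · exact hXe.1 hw
    · intro u hu v hv h
      rcases hXc u hu v hv h with h | h <;> simp [h]
    · have a1 := hXe.2 C hC
      have a2 : (X ∩ C).card ≤ C.card := Finset.card_le_card Finset.inter_subset_right
      have a3 : (insert t (insert s X)).card ≤ X.card + 2 :=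
        (Finset.card_insert_le _ _).trans (Nat.succ_le_succ (Finset.card_insert_le _ _))
      omega
  · apply le_of_eq; ring

/-! ### Counting the cover -/

/-- Register `18` becomes the number of vertices in the cover. -/
def countCover : Prog := .const 18 0 ;; forLoop 12 0 (.load 15 2 12 ;; .add 18 18 15)

theorem countCover_runs {σ : Store} {n : ℕ} {X : Finset ℕ} (h0 : σ.reg 0 = n) (h5 : σ.reg 5 = 1)
    (hX : Represents (σ.arr 2) X) (hXn : X ⊆ Finset.range n) :
    Runs countCover σ (4 * n + 3) fun τ => τ.reg 18 = X.card := by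
  refine ((Runs.flat rfl (Q := fun τ => τ.reg 18 = 0) (by simp [Prog.run])).seq
    fun τ hτ h18 => Runs.forLoop (n := n) (T := 2)
      (fun j τ => τ.reg 18 = ((X ∩ Finset.range j).card : ℤ)) rfl
      ((hτ.1 0 rfl).trans h0) ((hτ.1 5 rfl).trans h5) (by simp [h18]) ?_ ?_).le
      (by simp only [Prog.size]; omega)
  · intro j hj ρ hρ h12 h
    refine Runs.flat rfl ?_
    have hx : ρ.arr 2 = σ.arr 2 := (hρ.2 2 rfl).trans (hτ.2 2 rfl)
    simp only [Prog.run]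
    by_cases hjX : j ∈ X
    · have : X ∩ Finset.range (j + 1) = insert j (X ∩ Finset.range j) := by
        rw [Finset.range_add_one, Finset.inter_insert_of_mem hjX]
      rw [this, Finset.card_insert_of_notMem (by simp)]
      simp [h, h12, hx, hX j, hjX]
    · have : X ∩ Finset.range (j + 1) = X ∩ Finset.range j := by
        rw [Finset.range_add_one, Finset.inter_insert_of_notMem hjX]
      rw [this]
      simp [h, h12, hx, hX j, hjX]
  · intro ρ _ h
    rwa [Finset.inter_eq_left.2 hXn] at h

end RAM

namespace RAM

/-! ### Representatives of the twin classes -/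

/-- The vertices `u` and `v` have the same neighbors. -/
def Twin (n : ℕ) (E : ℕ → ℕ → Prop) (u v : ℕ) : Prop := ∀ j < n, E u j ↔ E v j

open Classical in
/-- The vertices of `X`, and those that have fewer than `b` smaller twins. -/
noncomputable def kept (n : ℕ) (E : ℕ → ℕ → Prop) (X : Finset ℕ) (b : ℕ) : Finset ℕ :=
  (Finset.range n).filter fun v =>
    v ∈ X ∨ ((Finset.range v).filter fun u => Twin n E u v).card < b

/-- The array `f` lists the elements of `K`. -/
def Lists (f : ℤ → ℤ) (K : Finset ℕ) : Prop :=
  (∀ j < K.card, ∃ v ∈ K, f (j : ℕ) = (v : ℕ)) ∧ ∀ v ∈ K, ∃ j < K.card, f (j : ℕ) = (v : ℕ)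

theorem Lists.update {f : ℤ → ℤ} {K : Finset ℕ} (h : Lists f K) {v : ℕ} (hv : v ∉ K) :
    Lists (Function.update f K.card v) (insert v K) := by
  refine ⟨fun j hj => ?_, fun w hw => ?_⟩
  · rw [Finset.card_insert_of_notMem hv] at hj
    rcases Nat.lt_succ_iff_lt_or_eq.1 hj with hj | rfl
    · obtain ⟨w, hw, hf⟩ := h.1 j hj
      exact ⟨w, by simp [hw], by simp [hj.ne, hf]⟩
    · exact ⟨v, by simp, by simp⟩
  · rw [Finset.card_insert_of_notMem hv]
    rcases Finset.mem_insert.1 hw with rfl | hw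
    · exact ⟨K.card, by omega, by simp⟩
    · obtain ⟨j, hj, hf⟩ := h.2 w hw
      exact ⟨j, by omega, by simp [hj.ne, hf]⟩

/-- Register `23` becomes `1` or `0` according to whether the vertices in the registers `12` and
`13` are twins. -/
def twinTest : Prog :=
  .const 23 1 ;; .load 24 1 12 ;; .load 25 1 13

/-- The comparison of two cells of the adjacency matrix. -/
def twinStep : Prog :=
  .add 26 24 14 ;; .load 26 0 26 ;; .add 27 25 14 ;; .load 27 0 27 ;;
  .ite (.eq 26 27) .skip (.const 23 0)

/-- Register `22` becomes the number of smaller twins of the vertex in register `12`. -/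
def countTwins : Prog :=
  .const 22 0 ;; forLoop 13 12 ((twinTest ;; forLoop 14 0 twinStep) ;; .add 22 22 23)

/-- The vertex in register `12` enters the list in array `3` if it is kept. -/
def keepStep : Prog :=
  .load 28 2 12 ;; .ite (.lt 22 20) (.const 28 1) .skip ;;
  .ite (.eq 28 5) (.store 3 21 12 ;; .add 21 21 5) .skip

/-- Array `3` becomes a list of the kept vertices, and register `21` its length. -/
def keep : Prog :=
  (.add 20 3 3 ;; .add 20 20 5 ;; .add 20 20 5 ;; .const 21 0) ;;
  forLoop 12 0 (countTwins ;; keepStep)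

open Classical in
theorem twinTest_runs {σ : Store} {n u v : ℕ} {E : ℕ → ℕ → Prop}
    (h0 : σ.reg 0 = n) (h5 : σ.reg 5 = 1) (h12 : σ.reg 12 = u) (h13 : σ.reg 13 = v)
    (hM : ∀ i : ℕ, i < n → σ.arr 1 i = i * n)
    (hE : Adjacency (σ.arr 0) n E) (hu : u < n) (hv : v < n) :
    Runs (twinTest ;; forLoop 14 0 twinStep) σ (9 * n + 5) fun τ =>
      τ.reg 23 = if Twin n E v u then 1 else 0 := by
  refine ((Runs.flat (p := twinTest) rfl (Q := fun τ => τ.reg 23 = 1 ∧ τ.reg 24 = u * n ∧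
    τ.reg 25 = v * n) (by simp [twinTest, Prog.run, h12, h13, hM u hu, hM v hv])).seq
    fun τ hτ ⟨h23, h24, h25⟩ => Runs.forLoop (n := n) (T := 7)
      -- After `j` columns the flag records whether the two rows agree on these columns, which is
      -- `Twin` with `j` in place of `n`.
      (fun j τ => τ.reg 23 = if Twin j E v u then 1 else 0) rfl
      ((hτ.1 0 rfl).trans h0) ((hτ.1 5 rfl).trans h5) (by simp [h23, Twin]) ?_
      (fun _ _ h => h)).le (by simp only [Prog.size, twinTest]; omega)
  intro j hj ρ hρ h14 h
  refine Runs.flat (p := twinStep) rfl ?_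
  have e0 : ρ.arr 0 = σ.arr 0 := (hρ.2 0 rfl).trans (hτ.2 0 rfl)
  have e24 : ρ.reg 24 = u * n := (hρ.1 24 rfl).trans h24
  have e25 : ρ.reg 25 = v * n := (hρ.1 25 rfl).trans h25
  have ht : Twin (j + 1) E v u ↔ Twin j E v u ∧ (E v j ↔ E u j) :=
    Nat.forall_lt_succ_right
  rw [ht]
  rcases hE u hu j hj with ⟨h1, h1'⟩ | ⟨h1, h1'⟩ <;>
  rcases hE v hv j hj with ⟨h2, h2'⟩ | ⟨h2, h2'⟩ <;>
  simp [twinStep, Prog.run, Test.Holds, h14, h, e0, e24, e25, h1, h2, h1', h2']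

open Classical in
theorem countTwins_runs {σ : Store} {n v : ℕ} {E : ℕ → ℕ → Prop}
    (h0 : σ.reg 0 = n) (h5 : σ.reg 5 = 1) (h12 : σ.reg 12 = v)
    (hM : ∀ i : ℕ, i < n → σ.arr 1 i = i * n) (hE : Adjacency (σ.arr 0) n E) (hv : v < n) :
    Runs countTwins σ (n * (9 * n + 8) + 3) fun τ =>
      τ.reg 22 = ((Finset.range v).filter fun u => Twin n E u v).card := by
  refine ((Runs.flat rfl (Q := fun τ => τ.reg 22 = 0) (by simp [Prog.run])).seq
    fun τ hτ h22 => Runs.forLoop (n := v) (T := 9 * n + 5 + 1)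
      (fun j τ => τ.reg 22 = ((Finset.range j).filter fun u => Twin n E u v).card) rfl
      ((hτ.1 12 rfl).trans h12) ((hτ.1 5 rfl).trans h5) (by simp [h22]) ?_
      (fun _ _ h => h)).le ?_
  · intro u hu ρ hρ h13 h
    refine (twinTest_runs (n := n) (u := v) (v := u) (E := E) ?_ ?_ ?_ h13 ?_ ?_ hv
      (hu.trans hv)).seq fun ρ' hρ' h23 => Runs.flat (p := .add 22 22 23) rfl ?_
    · rw [hρ.1 0 rfl, hτ.1 0 rfl, h0]
    · rw [hρ.1 5 rfl, hτ.1 5 rfl, h5]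
    · rw [hρ.1 12 rfl, hτ.1 12 rfl, h12]
    · rw [hρ.2 1 rfl, hτ.2 1 rfl]; exact hM
    · rw [hρ.2 0 rfl, hτ.2 0 rfl]; exact hE
    · rw [Finset.range_add_one, Finset.filter_insert]
      by_cases ht : Twin n E u v
      · simp [Prog.run, h23, ht, hρ'.1 22 rfl, h]
      · simp [Prog.run, h23, ht, hρ'.1 22 rfl, h]
  · have : v * (9 * n + 5 + 1 + 2) ≤ n * (9 * n + 8) := Nat.mul_le_mul hv.le (by omega)
    simp only [Prog.size]
    omega

theorem keep_runs {σ : Store} {n d : ℕ} {E : ℕ → ℕ → Prop} {X : Finset ℕ}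
    (h0 : σ.reg 0 = n) (h3 : σ.reg 3 = d) (h5 : σ.reg 5 = 1)
    (hM : ∀ i : ℕ, i < n → σ.arr 1 i = i * n) (hE : Adjacency (σ.arr 0) n E)
    (hX : Represents (σ.arr 2) X) :
    Runs keep σ (n * (n * (9 * n + 8) + 13) + 6) fun τ =>
      τ.reg 21 = (kept n E X (2 * d + 2)).card ∧ Lists (τ.arr 3) (kept n E X (2 * d + 2)) := by
  classical
  refine ((Runs.flat rfl (Q := fun τ => τ.reg 20 = (2 * d + 2 : ℕ) ∧ τ.reg 21 = 0)
    (by simp [Prog.run, h3, h5]; ring)).seq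
    fun τ hτ ⟨h20, h21⟩ => Runs.forLoop (n := n) (T := n * (9 * n + 8) + 3 + 8)
      (fun j τ => τ.reg 21 = ((kept n E X (2 * d + 2)).filter (· < j)).card ∧
        Lists (τ.arr 3) ((kept n E X (2 * d + 2)).filter (· < j))) rfl
      ((hτ.1 0 rfl).trans h0) ((hτ.1 5 rfl).trans h5) (by simp [h21, Lists]) ?_ ?_).le
      (by apply le_of_eq; simp only [Prog.size]; ring)
  · rintro v hv ρ hρ h12 ⟨hm, hl⟩
    have e5 : ρ.reg 5 = 1 := by rw [hρ.1 5 rfl, hτ.1 5 rfl, h5]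
    refine (countTwins_runs (n := n) (v := v) (E := E) ?_ e5 h12 ?_ ?_ hv).seq
      fun ρ' hρ' h22 => Runs.flat (p := keepStep) rfl ?_
    · rw [hρ.1 0 rfl, hτ.1 0 rfl, h0]
    · rw [hρ.2 1 rfl, hτ.2 1 rfl]; exact hM
    · rw [hρ.2 0 rfl, hτ.2 0 rfl]; exact hE
    · have f2 : ρ'.arr 2 v = if v ∈ X then 1 else 0 := by
        rw [hρ'.2 2 rfl, hρ.2 2 rfl, hτ.2 2 rfl, hX v]
      have f3 := hρ'.2 3 rfl
      have f5 := (hρ'.1 5 rfl).trans e5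
      have f12 := (hρ'.1 12 rfl).trans h12
      have f20 : ρ'.reg 20 = (2 * d + 2 : ℕ) := by rw [hρ'.1 20 rfl, hρ.1 20 rfl, h20]
      have f21 := (hρ'.1 21 rfl).trans hm
      have hiff : v ∈ kept n E X (2 * d + 2) ↔
          v ∈ X ∨ ((Finset.range v).filter fun u => Twin n E u v).card < 2 * d + 2 := by
        simp [kept, hv]
      have hcond : ρ'.reg 22 < ρ'.reg 20 ↔
          ((Finset.range v).filter fun u => Twin n E u v).card < 2 * d + 2 := by
        rw [h22, f20, Nat.cast_lt]
      by_cases hk : v ∈ kept n E X (2 * d + 2)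
      · have hins : (kept n E X (2 * d + 2)).filter (· < v + 1) =
            insert v ((kept n E X (2 * d + 2)).filter (· < v)) := by
          ext w
          simp only [Finset.mem_filter, Finset.mem_insert, Nat.lt_succ_iff_lt_or_eq]
          constructor
          · tauto
          · rintro (rfl | h) <;> tauto
        have hv' : v ∉ (kept n E X (2 * d + 2)).filter (· < v) := by simp
        rw [hins, Finset.card_insert_of_notMem hv']
        have hl' := hl.update hv'
        by_cases hc : ρ'.reg 22 < ρ'.reg 20
        · simpa [keepStep, Prog.run, Test.Holds, hc, f5, f12, f21, f3] using hl'
        · have hvX : v ∈ X := (hiff.1 hk).resolve_right fun h => hc (hcond.2 h)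
          simpa [keepStep, Prog.run, Test.Holds, hc, f2, hvX, f5, f12, f21, f3] using hl'
      · have hins : (kept n E X (2 * d + 2)).filter (· < v + 1) =
            (kept n E X (2 * d + 2)).filter (· < v) := by
          ext w
          simp only [Finset.mem_filter, Nat.lt_succ_iff_lt_or_eq]
          constructor
          · rintro ⟨h, h' | rfl⟩ <;> tauto
          · tauto
        rw [hins]
        rw [hiff, not_or, ← hcond] at hk
        simpa [keepStep, Prog.run, Test.Holds, hk, f2, f5, f12, f21, f3] using hl
  · intro ρ _ h
    have : (kept n E X (2 * d + 2)).filter (· < n) = kept n E X (2 * d + 2) := by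
      ext w; simp [kept]; tauto
    rwa [this] at h

/-! ### Mixed radix numerals -/

/-- What is left of `c` after the division by the first `i` bases. -/
def quot (b : ℕ → ℕ) (c : ℕ) : ℕ → ℕ
  | 0 => c
  | i + 1 => quot b c i / b i

/-- The digit of `c` at position `i`. -/
def digit (b : ℕ → ℕ) (c i : ℕ) : ℕ := quot b c i % b i

theorem quot_le (b : ℕ → ℕ) (c i : ℕ) : quot b c i ≤ c := by
  induction i with
  | zero => exact le_rfl
  | succ i ih => exact (Nat.div_le_self _ _).trans ih

/-- The definition peels off the last base; the induction in `exists_digit_eq` peels off the first.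
-/
theorem quot_succ (b : ℕ → ℕ) (c i : ℕ) :
    quot b c (i + 1) = quot (fun j => b (j + 1)) (c / b 0) i := by
  induction i with
  | zero => rfl
  | succ i ih => rw [quot, ih, quot]

/-- Completeness of the enumeration: a counter below the product of the bases meets every choice of
digits. That it meets each only once is irrelevant. -/
theorem exists_digit_eq (L : ℕ) (b f : ℕ → ℕ) (hf : ∀ i < L, f i < b i) :
    ∃ c < ∏ i ∈ Finset.range L, b i, ∀ i < L, digit b c i = f i := by
  induction L generalizing b f with
  | zero => exact ⟨0, by simp, by simp⟩
  | succ L ih =>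
    obtain ⟨c, hc, hd⟩ := ih (fun i => b (i + 1)) (fun i => f (i + 1)) fun i hi =>
      hf (i + 1) (by omega)
    have h0 := hf 0 (by omega)
    refine ⟨f 0 + b 0 * c, ?_, fun i hi => ?_⟩
    · rw [Finset.prod_range_succ']
      calc f 0 + b 0 * c < b 0 + b 0 * c := by omega
        _ = b 0 * (c + 1) := by ring
        _ ≤ b 0 * ∏ i ∈ Finset.range L, b (i + 1) := Nat.mul_le_mul le_rfl hc
        _ = _ := mul_comm _ _
    · rcases i with _ | i
      · simp [digit, quot, Nat.mod_eq_of_lt h0]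
      · rw [digit, quot_succ, Nat.add_mul_div_left _ _ (by omega), Nat.div_eq_of_lt h0, zero_add]
        exact hd i (by omega)

/-- Register `45` becomes the product of the first cells of array `u`, whose number is in
register `44`. -/
def product (u : ℕ) : Prog :=
  .const 45 1 ;; forLoop 40 44 ((.load 41 u 40 ;; .const 42 0) ;; forLoop 43 41 (.add 42 42 45) ;;
    .copy 45 42)

/-- Each factor is multiplied in by adding the current product to itself `b i` times, so the time
depends on the bound `β` for the factors and not on the size of the product. -/
theorem product_runs {σ : Store} {u L β : ℕ} {b : ℕ → ℕ} (h5 : σ.reg 5 = 1) (h44 : σ.reg 44 = L)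
    (hb : ∀ i : ℕ, i < L → σ.arr u i = b i) (hβ : ∀ i < L, b i ≤ β) :
    Runs (product u) σ (L * (3 * β + 7) + 3) fun τ =>
      τ.reg 45 = (∏ i ∈ Finset.range L, b i : ℕ) := by
  refine ((Runs.flat rfl (Q := fun τ => τ.reg 45 = 1) (by simp [Prog.run])).seq
    fun τ hτ h45 => Runs.forLoop (n := L) (T := 2 + (β * 3 + 2 + 1))
      (fun j τ => τ.reg 45 = (∏ i ∈ Finset.range j, b i : ℕ)) rfl
      ((hτ.1 44 rfl).trans h44) ((hτ.1 5 rfl).trans h5) (by simp [h45]) ?_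
      (fun _ _ h => h)).le (by apply le_of_eq; simp only [Prog.size]; ring)
  intro i hi ρ hρ h40 h
  have e5 : ρ.reg 5 = 1 := by rw [hρ.1 5 rfl, hτ.1 5 rfl, h5]
  have eu : ρ.arr u = σ.arr u := by rw [hρ.2 u rfl, hτ.2 u rfl]
  refine (Runs.flat (p := .load 41 u 40 ;; .const 42 0) rfl
    (Q := fun τ => τ.reg 41 = b i ∧ τ.reg 42 = 0)
    (by simp [Prog.run, h40, eu, hb i hi])).seq fun ρ' hρ' ⟨h41, h42⟩ => ?_
  refine (((Runs.forLoop (n := b i) (T := 1) (fun j τ => τ.reg 42 = j * ρ.reg 45) rfl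
    h41 ((hρ'.1 5 rfl).trans e5) (by simp [h42]) (fun j hj τ' hτ' h43 h' => ?_)
    (fun _ _ h => h)).le ?_).seq fun τ' hτ' h' => Runs.flat (p := .copy 45 42) rfl ?_)
  · refine Runs.flat (p := .add 42 42 45) rfl ?_
    simp [Prog.run, h', hτ'.1 45 rfl, hρ'.1 45 rfl]
    ring
  · have := hβ i hi
    omega
  · rw [Finset.prod_range_succ]
    simp [Prog.run, h', h]
    ring

/-- Division of register `46` by register `41` with remainder: the quotient is added to
register `42`. -/
def divide : Prog := .loop (.lt 47 46) (.sub 46 46 41 ;; .add 42 42 5)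

/-- Tests are strict, so register `47` holds `b - 1`: the loop continues exactly while `b ≤ r`. Each
round takes three steps and lowers `r` by at least one. -/
theorem divide_runs {σ : Store} {b r q : ℕ} (hb : 0 < b) (h5 : σ.reg 5 = 1) (h41 : σ.reg 41 = b)
    (h42 : σ.reg 42 = q) (h46 : σ.reg 46 = r) (h47 : σ.reg 47 = b - 1) :
    Runs divide σ (3 * r + 1) fun τ =>
      τ.reg 46 = (r % b : ℕ) ∧ τ.reg 42 = (q + r / b : ℕ) := by
  induction r using Nat.strong_induction_on generalizing q σ with
  | _ r ih =>
    by_cases hr : r < b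
    · refine ⟨σ, 1, .loopFalse ?_, by omega, ?_, ?_⟩
      · simp only [Test.Holds]; omega
      · rw [h46, Nat.mod_eq_of_lt hr]
      · rw [h42, Nat.div_eq_of_lt hr, add_zero]
    · have hr : b ≤ r := by omega
      have he := (Exec.sub 46 46 41 σ).seq (Exec.add 42 42 5 _)
      obtain ⟨τ, k, hk, hkT, h⟩ := ih (r - b) (by omega) (q := q + 1)
        (σ := (σ.setReg 46 (σ.reg 46 - σ.reg 41)).setReg 42
          ((σ.setReg 46 (σ.reg 46 - σ.reg 41)).reg 42 +
            (σ.setReg 46 (σ.reg 46 - σ.reg 41)).reg 5))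
        (by simp [h5]) (by simp [h41]) (by simp [h42, h5])
        (by simp [h46, h41, Nat.cast_sub hr]) (by simp [h47])
      refine ⟨τ, _, .loopTrue ?_ he hk, by omega, ?_, ?_⟩
      · simp only [Test.Holds]; omega
      · rw [h.1, ← Nat.mod_eq_sub_mod hr]
      · rw [h.2, Nat.div_eq_sub_div hb hr]; push_cast; ring

/-- The digits of register `46` in the bases of array `u` are written into array `w`; their number
is in register `44`. -/
def decode (u w : ℕ) : Prog :=
  forLoop 40 44 ((.load 41 u 40 ;; .const 42 0 ;; .sub 47 41 5) ;; divide ;;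
    .store w 40 46 ;; .copy 46 42)

theorem decode_runs {σ : Store} {u w L c : ℕ} {b : ℕ → ℕ} (huw : u ≠ w) (h5 : σ.reg 5 = 1)
    (h44 : σ.reg 44 = L) (h46 : σ.reg 46 = c)
    (hb : ∀ i : ℕ, i < L → σ.arr u i = b i) (hpos : ∀ i < L, 0 < b i) :
    Runs (decode u w) σ (L * (3 * c + 8) + 2) fun τ =>
      ∀ i : ℕ, i < L → τ.arr w i = digit b c i := by
  refine (Runs.forLoop (n := L) (T := 3 + (3 * c + 1 + 2))
      (fun j τ => τ.reg 46 = quot b c j ∧ ∀ i : ℕ, i < j → τ.arr w i = digit b c i) rfl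
      h44 h5 (by simp [h46, quot]) ?_ (fun _ _ h => h.2)).le (by apply le_of_eq; ring)
  rintro i hi τ hτ h40 ⟨hq, hd⟩
  have e5 : τ.reg 5 = 1 := by rw [hτ.1 5 rfl, h5]
  have eu : τ.arr u = σ.arr u := hτ.2 u (by simp [forLoop, Prog.wa, divide, huw])
  refine (Runs.flat (p := .load 41 u 40 ;; .const 42 0 ;; .sub 47 41 5) rfl
    (Q := fun τ => τ.reg 41 = b i ∧ τ.reg 42 = 0 ∧ τ.reg 47 = b i - 1)
    (by simp [Prog.run, h40, eu, hb i hi, e5])).seq fun ρ hρ ⟨h41, h42, h47⟩ => ?_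
  refine ((divide_runs (q := 0) (hpos i hi) ((hρ.1 5 rfl).trans e5) h41 (by simpa using h42)
    ((hρ.1 46 rfl).trans hq) h47).le ?_).seq fun ρ' hρ' ⟨h46', h42'⟩ =>
    Runs.flat (p := .store w 40 46 ;; .copy 46 42) rfl ?_
  -- Quotients never exceed `c`, so one bound serves for every division.
  · have := quot_le b c i
    omega
  · have e40 : ρ'.reg 40 = i := by rw [hρ'.1 40 rfl, hρ.1 40 rfl, h40]
    have ew : ρ'.arr w = τ.arr w := by rw [hρ'.2 w rfl, hρ.2 w rfl]
    refine ⟨by simp [Prog.run, h42', quot], fun j hj => ?_⟩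
    rcases Nat.lt_succ_iff_lt_or_eq.1 hj with hj | rfl
    · simp [Prog.run, e40, ew, hj.ne, hd j hj]
    · simp [Prog.run, e40, h46', digit]

end RAM

namespace RAM

/-! ### The weights of the edges -/

/-- One of the first `j` pairs `{p i, p (d + i)}` is `{u, v}`. -/
def Defended (p : ℕ → ℕ) (d j u v : ℕ) : Prop :=
  ∃ i < j, (u = p i ∧ v = p (d + i)) ∨ (u = p (d + i) ∧ v = p i)

open Classical in
/-- A defended edge has weight `a + 1`, any other edge has weight `1`. -/
noncomputable def weight (E : ℕ → ℕ → Prop) (p : ℕ → ℕ) (d : ℕ) (a : ℤ) (j u v : ℕ) : ℤ :=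
  if E u v then if Defended p d j u v then a + 1 else 1 else 0

/-- The pair of number `i`, in register `12`, becomes a defended edge, if it is an edge. -/
def defendStep : Prog :=
  .load 17 5 12 ;; .load 17 3 17 ;; .add 60 12 3 ;; .load 60 5 60 ;; .load 60 3 60 ;;
  .load 61 1 17 ;; .add 61 61 60 ;; .load 62 1 60 ;; .add 62 62 17 ;; .load 24 0 61 ;;
  .ite (.eq 24 5) (.store 6 61 16 ;; .store 6 62 16) .skip

/-- Array `6` becomes the matrix of the weights. -/
def setWeights : Prog :=
  forLoop 12 10 (.load 15 0 12 ;; .store 6 12 15) ;; .add 16 4 5 ;; forLoop 12 3 defendStep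

theorem address_inj {n u v u' v' : ℕ} (hv : v < n) (hv' : v' < n) :
    (u : ℤ) * n + v = u' * n + v' ↔ u = u' ∧ v = v' := by
  constructor
  · intro h
    have h : u * n + v = u' * n + v' := by exact_mod_cast h
    have h1 := congrArg (· / n) h
    have h2 := congrArg (· % n) h
    simp only [Nat.mul_add_mod_self_right, Nat.mod_eq_of_lt hv, Nat.mod_eq_of_lt hv'] at h2
    have hn : 0 < n := by omega
    simp only [mul_comm _ n, Nat.mul_add_div hn, Nat.div_eq_of_lt hv, Nat.div_eq_of_lt hv'] at h1
    omega
  · rintro ⟨rfl, rfl⟩; rfl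

/-- Both orientations are written because the matrix is symmetric. A listed pair that is not an edge
is skipped, so arbitrary pairs of vertices may serve to encode a defense. -/
theorem defendStep_runs {σ : Store} {n d i : ℕ} {a : ℤ} {E : ℕ → ℕ → Prop} {p : ℕ → ℕ}
    (h3 : σ.reg 3 = d) (h5 : σ.reg 5 = 1) (h12 : σ.reg 12 = i) (h16 : σ.reg 16 = a + 1)
    (hM : ∀ i : ℕ, i < n → σ.arr 1 i = i * n) (hE : Adjacency (σ.arr 0) n E)
    (hs : ∀ u v, E u v → E v u) (hi : i < d)
    (hp : ∀ i < 2 * d, p i < n ∧ σ.arr 3 (σ.arr 5 i) = p i)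
    (hw : ∀ u < n, ∀ v < n, σ.arr 6 (u * n + v) = weight E p d a i u v) :
    Runs defendStep σ 14 fun τ =>
      ∀ u < n, ∀ v < n, τ.arr 6 (u * n + v) = weight E p d a (i + 1) u v := by
  refine Runs.flat (p := defendStep) rfl fun u hu v hv => ?_
  obtain ⟨p1, e1⟩ := hp i (by omega)
  obtain ⟨p2, e2⟩ := hp (d + i) (by omega)
  have e2' : σ.arr 3 (σ.arr 5 ((i : ℤ) + d)) = p (d + i) := by
    rw [← e2]; push_cast; rw [add_comm]
  have hd : Defended p d (i + 1) u v ↔ Defended p d i u v ∨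
      ((u = p i ∧ v = p (d + i)) ∨ (u = p (d + i) ∧ v = p i)) := by
    constructor
    · rintro ⟨k, hk, h⟩
      rcases Nat.lt_succ_iff_lt_or_eq.1 hk with hk | rfl
      · exact .inl ⟨k, hk, h⟩
      · exact .inr h
    · rintro (⟨k, hk, h⟩ | h)
      · exact ⟨k, by omega, h⟩
      · exact ⟨i, by omega, h⟩
  have hw' := hw u hu v hv
  unfold weight at hw' ⊢
  rw [hd]
  rcases hE _ p1 _ p2 with ⟨h, h'⟩ | ⟨h, h'⟩
  · have e : (defendStep.run σ).arr 6 = Function.update (Function.update (σ.arr 6)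
        (p i * n + p (d + i)) (a + 1)) (p (d + i) * n + p i) (a + 1) := by
      simp [defendStep, Prog.run, Test.Holds, h12, e1, h3, e2', hM _ p1, hM _ p2, h, h5, h16]
    rw [e, Function.update_apply, Function.update_apply, hw']
    simp only [address_inj hv p1, address_inj hv p2]
    have h1 : u = p i ∧ v = p (d + i) → E u v := by rintro ⟨rfl, rfl⟩; exact h'
    have h2 : u = p (d + i) ∧ v = p i → E u v := by rintro ⟨rfl, rfl⟩; exact hs _ _ h'
    by_cases c1 : u = p i ∧ v = p (d + i)
    · simp [c1, h']
    · by_cases c2 : u = p (d + i) ∧ v = p i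
      · simp [c2, hs _ _ h']
      · by_cases hh : Defended p d i u v <;> simp [c1, c2, hh]
  · have e : (defendStep.run σ).arr 6 = σ.arr 6 := by
      simp [defendStep, Prog.run, Test.Holds, h12, e1, h3, e2', hM _ p1, hM _ p2, h, h5]
    have h1 : E u v → ¬ ((u = p i ∧ v = p (d + i)) ∨ (u = p (d + i) ∧ v = p i)) := by
      rintro hh (⟨rfl, rfl⟩ | ⟨rfl, rfl⟩)
      · exact h' hh
      · exact h' (hs _ _ hh)
    rw [e, hw']
    by_cases hh : E u v
    · by_cases hh' : Defended p d i u v <;> simp [hh, h1 hh, hh']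
    · simp [hh]

theorem setWeights_runs {σ : Store} {n d : ℕ} {a : ℤ} {E : ℕ → ℕ → Prop} {p : ℕ → ℕ}
    (h3 : σ.reg 3 = d) (h4 : σ.reg 4 = a) (h5 : σ.reg 5 = 1) (h10 : σ.reg 10 = n * n)
    (hM : ∀ i : ℕ, i < n → σ.arr 1 i = i * n) (hE : Adjacency (σ.arr 0) n E)
    (hs : ∀ u v, E u v → E v u) (hp : ∀ i < 2 * d, p i < n ∧ σ.arr 3 (σ.arr 5 i) = p i) :
    Runs setWeights σ (4 * n * n + 16 * d + 5) fun τ =>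
      ∀ u < n, ∀ v < n, τ.arr 6 (u * n + v) = weight E p d a d u v := by
  refine ((Runs.forLoop (n := n * n) (T := 2) (fun j τ => ∀ i : ℕ, i < j → τ.arr 6 i = σ.arr 0 i)
    rfl (by rw [h10]; push_cast; rfl) h5 (by simp) ?_ (fun _ _ h => h)).seq fun τ hτ h =>
    (Runs.flat (p := .add 16 4 5) rfl (Q := fun ρ => ρ.reg 16 = a + 1) ?_).seq fun ρ hρ h16 =>
    Runs.forLoop (n := d) (T := 14)
      (fun j τ => ∀ u < n, ∀ v < n, τ.arr 6 (u * n + v) = weight E p d a j u v) rfl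
      ?_ ?_ ?_ ?_ (fun _ _ h => h)).le (by apply le_of_eq; simp only [Prog.size]; ring)
  · intro j hj τ hτ h12 h
    refine Runs.flat rfl fun i hi => ?_
    rcases Nat.lt_succ_iff_lt_or_eq.1 hi with hi | rfl
    · simp [Prog.run, h12, hi.ne, h i hi]
    · simp [Prog.run, h12, hτ.2 0 rfl]
  · simp [Prog.run, hτ.1 4 rfl, hτ.1 5 rfl, h4, h5]
  · rw [hρ.1 3 rfl, hτ.1 3 rfl, h3]
  · rw [hρ.1 5 rfl, hτ.1 5 rfl, h5]
  · intro u hu v hv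
    have : u * n + v < n * n := by nlinarith
    have := h _ this
    push_cast at this
    rw [Store.arr_setReg, hρ.2 6 rfl, this]
    have hd : ¬ Defended p d 0 u v := by simp [Defended]
    rcases hE u hu v hv with ⟨h1, h2⟩ | ⟨h1, h2⟩ <;> simp [weight, h1, h2, hd]
  · intro j hj κ hκ h12 h'
    refine (defendStep_runs (n := n) (d := d) (i := j) (a := a) (E := E) (p := p) ?_ ?_ h12 ?_ ?_
      ?_ hs hj ?_ h').mono le_rfl fun _ _ hq => by simpa using hq
    · rw [hκ.1 3 rfl, hρ.1 3 rfl, hτ.1 3 rfl, h3]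
    · rw [hκ.1 5 rfl, hρ.1 5 rfl, hτ.1 5 rfl, h5]
    · rw [hκ.1 16 rfl, h16]
    · rw [hκ.2 1 rfl, hρ.2 1 rfl, hτ.2 1 rfl]; exact hM
    · rw [hκ.2 0 rfl, hρ.2 0 rfl, hτ.2 0 rfl]; exact hE
    · rw [hκ.2 3 rfl, hρ.2 3 rfl, hτ.2 3 rfl, hκ.2 5 rfl, hρ.2 5 rfl, hτ.2 5 rfl]; exact hp

/-! ### The cheapest extension of a side assignment -/

/-- The weight between `v` and the vertices `u` of `X` that satisfy `P`. -/
def weightTo (n : ℕ) (w : ℕ → ℕ → ℤ) (X : Finset ℕ) (P : ℕ → Prop) [DecidablePred P] (v : ℕ) : ℤ :=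
  ∑ u ∈ Finset.range n, if u ∈ X ∧ P u then w u v else 0

/-- The share of `v` in the weight of the cut. -/
def share (n : ℕ) (w : ℕ → ℕ → ℤ) (X : Finset ℕ) (y : ℕ → ℕ) (v : ℕ) : ℤ :=
  if v ∈ X then if y v = 0 then weightTo n w X (fun u => y u ≠ 0) v else 0
  else min (weightTo n w X (fun u => y u ≠ 0) v) (weightTo n w X (fun u => y u = 0) v)

/-- The least weight of a cut for which the vertices of `X` are on the sides that `y` gives. -/
def cutCost (n : ℕ) (w : ℕ → ℕ → ℤ) (X : Finset ℕ) (y : ℕ → ℕ) : ℤ :=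
  ∑ v ∈ Finset.range n, share n w X y v

/-- The weight between the vertices in the registers `54` and `51` is taken into account. -/
def costStep : Prog :=
  .load 55 1 54 ;; .add 55 55 51 ;; .load 55 6 55 ;; .load 56 2 54 ;; .load 57 8 54 ;;
  .ite (.eq 56 5) (.ite (.eq 57 6) (.add 53 53 55) (.add 52 52 55)) .skip

/-- The share of the vertex in register `51` is added to register `50`. -/
def addShare : Prog :=
  .load 56 2 51 ;; .load 57 8 51 ;;
  .ite (.eq 56 5) (.ite (.eq 57 6) (.add 50 50 52) .skip)
    (.ite (.lt 52 53) (.add 50 50 52) (.add 50 50 53))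

/-- Register `50` becomes the least weight of a cut for which the vertices of the cover are on the
sides that array `8` gives. -/
def cost : Prog :=
  .const 50 0 ;; forLoop 51 0 (((.const 52 0 ;; .const 53 0) ;; forLoop 54 0 costStep) ;; addShare)

theorem cost_runs {σ : Store} {n : ℕ} {w : ℕ → ℕ → ℤ} {X : Finset ℕ} {y : ℕ → ℕ}
    (h0 : σ.reg 0 = n) (h5 : σ.reg 5 = 1) (h6 : σ.reg 6 = 0)
    (hM : ∀ i : ℕ, i < n → σ.arr 1 i = i * n) (hX : Represents (σ.arr 2) X)
    (hw : ∀ u < n, ∀ v < n, σ.arr 6 (u * n + v) = w u v) (hy : ∀ i : ℕ, i < n → σ.arr 8 i = y i) :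
    Runs cost σ (n * (12 * n + 15) + 3) fun τ => τ.reg 50 = cutCost n w X y := by
  refine ((Runs.flat rfl (Q := fun τ => τ.reg 50 = 0) (by simp [Prog.run])).seq
    fun τ hτ h50 => Runs.forLoop (n := n) (T := (2 + (n * 12 + 2)) + addShare.size)
      (fun j τ => τ.reg 50 = ∑ v ∈ Finset.range j, share n w X y v) rfl
      ((hτ.1 0 rfl).trans h0) ((hτ.1 5 rfl).trans h5) (by simp [h50]) ?_
      (fun _ _ h => h)).le (by apply le_of_eq; simp only [Prog.size, addShare]; ring)
  intro v hv ρ hρ h51 h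
  have e0 : ρ.reg 0 = n := by rw [hρ.1 0 rfl, hτ.1 0 rfl, h0]
  have e5 : ρ.reg 5 = 1 := by rw [hρ.1 5 rfl, hτ.1 5 rfl, h5]
  have e6 : ρ.reg 6 = 0 := by rw [hρ.1 6 rfl, hτ.1 6 rfl, h6]
  have a1 : ρ.arr 1 = σ.arr 1 := by rw [hρ.2 1 rfl, hτ.2 1 rfl]
  have a2 : ρ.arr 2 = σ.arr 2 := by rw [hρ.2 2 rfl, hτ.2 2 rfl]
  have a6 : ρ.arr 6 = σ.arr 6 := by rw [hρ.2 6 rfl, hτ.2 6 rfl]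
  have a8 : ρ.arr 8 = σ.arr 8 := by rw [hρ.2 8 rfl, hτ.2 8 rfl]
  refine (((Runs.flat (p := .const 52 0 ;; .const 53 0) rfl
    (Q := fun τ => τ.reg 52 = 0 ∧ τ.reg 53 = 0) (by simp [Prog.run])).seq
    fun κ hκ ⟨h52, h53⟩ => Runs.forLoop (n := n) (T := 10)
      (fun j τ => τ.reg 52 = weightTo j w X (fun u => y u ≠ 0) v ∧
        τ.reg 53 = weightTo j w X (fun u => y u = 0) v) rfl
      ((hκ.1 0 rfl).trans e0) ((hκ.1 5 rfl).trans e5) (by simp [h52, h53, weightTo]) ?_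
      (fun _ _ h => h))).seq fun κ hκ ⟨h52, h53⟩ => (Runs.flat (p := addShare) rfl ?_).le le_rfl
  · rintro u hu μ hμ h54 ⟨h52', h53'⟩
    refine (Runs.flat (p := costStep) rfl ?_).le (by simp [costStep, Prog.size])
    have f1 := (hμ.2 1 rfl).trans ((hκ.2 1 rfl).trans a1)
    have f2 := (hμ.2 2 rfl).trans ((hκ.2 2 rfl).trans a2)
    have f6 := (hμ.2 6 rfl).trans ((hκ.2 6 rfl).trans a6)
    have f8 := (hμ.2 8 rfl).trans ((hκ.2 8 rfl).trans a8)
    have g5 := (hμ.1 5 rfl).trans ((hκ.1 5 rfl).trans e5)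
    have g6 := (hμ.1 6 rfl).trans ((hκ.1 6 rfl).trans e6)
    have g51 := (hμ.1 51 rfl).trans ((hκ.1 51 rfl).trans h51)
    have hXu := hX u
    unfold weightTo at h52' h53' ⊢
    rw [Finset.sum_range_succ, Finset.sum_range_succ]
    by_cases c1 : u ∈ X
    · by_cases c2 : y u = 0 <;>
      simp [costStep, Prog.run, Test.Holds, h54, f1, f2, f6, f8, g5, g6, g51, hM u hu, hXu, c1,
        hw u hu v hv, hy u hu, c2, h52', h53']
    · simp [costStep, Prog.run, Test.Holds, h54, f1, f2, f6, f8, g5, g51, hM u hu, hXu, c1,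
        hw u hu v hv, hy u hu, h52', h53']
  · have f2 := (hκ.2 2 rfl).trans a2
    have f8 := (hκ.2 8 rfl).trans a8
    have g5 := (hκ.1 5 rfl).trans e5
    have g6 := (hκ.1 6 rfl).trans e6
    have g51 := (hκ.1 51 rfl).trans h51
    have g50 := (hκ.1 50 rfl).trans h
    have hXv := hX v
    rw [Finset.sum_range_succ]
    generalize ∑ v ∈ Finset.range v, share n w X y v = S at g50 ⊢
    unfold share
    by_cases c1 : v ∈ X
    · by_cases c2 : y v = 0 <;>
      simp [addShare, Prog.run, Test.Holds, f2, f8, g5, g6, g51, g50, hXv, c1, hy v hv, c2, h52]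
    · by_cases c2 : weightTo n w X (fun u => y u ≠ 0) v < weightTo n w X (fun u => y u = 0) v
      · have := min_eq_left c2.le
        simp only [ne_eq] at this c2
        simp [addShare, Prog.run, Test.Holds, f2, f8, g5, g51, g50, hXv, c1, hy v hv, c2, h52,
          h53, this]
      · have := min_eq_right (not_lt.1 c2)
        simp only [ne_eq] at this c2
        simp [addShare, Prog.run, Test.Holds, f2, f8, g5, g51, g50, hXv, c1, hy v hv, c2, h52,
          h53, this]

end RAM

namespace RAM

/-! ### The search -/

/-- The number of sides between which a vertex has to be assigned: only the vertices of `X` have a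
choice. -/
def sideBase (X : Finset ℕ) (v : ℕ) : ℕ := if v ∈ X then 2 else 1

/-- The bases of the numerals for the defenses and the side assignments, in the arrays `4` and `7`;
their products, in the registers `30` and `31`. -/
def setBases : Prog :=
  .add 29 3 3 ;; forLoop 12 29 (.store 4 12 21) ;;
  forLoop 12 0 (.load 15 2 12 ;; .add 15 15 5 ;; .store 7 12 15) ;;
  .copy 44 29 ;; product 4 ;; (.copy 30 45 ;; .copy 44 0) ;; product 7 ;; .copy 31 45

theorem setBases_runs {σ : Store} {n d m : ℕ} {X : Finset ℕ} (h0 : σ.reg 0 = n)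
    (h3 : σ.reg 3 = d) (h5 : σ.reg 5 = 1) (h21 : σ.reg 21 = m) (hX : Represents (σ.arr 2) X) :
    Runs setBases σ (2 * d * (3 * m + 10) + 18 * n + 15) fun τ =>
      τ.reg 29 = (2 * d : ℕ) ∧ τ.reg 30 = (m ^ (2 * d) : ℕ) ∧
      τ.reg 31 = (∏ v ∈ Finset.range n, sideBase X v : ℕ) ∧
      (∀ i : ℕ, i < 2 * d → τ.arr 4 i = m) ∧ ∀ v : ℕ, v < n → τ.arr 7 v = sideBase X v := by
  refine ((Runs.flat (p := .add 29 3 3) rfl (Q := fun τ => τ.reg 29 = (2 * d : ℕ))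
      (by simp [Prog.run, h3]; ring)).seq fun τ₁ s₁ q₁ =>
    (Runs.forLoop (n := 2 * d) (T := 1) (fun j τ => ∀ i : ℕ, i < j → τ.arr 4 i = m) rfl
      q₁ ((s₁.1 5 rfl).trans h5) (by simp) ?_ (fun _ _ h => h)).seq fun τ₂ s₂ q₂ =>
    (Runs.forLoop (n := n) (T := 3) (fun j τ => ∀ i : ℕ, i < j → τ.arr 7 i = sideBase X i) rfl
      ?_ ?_ (by simp) ?_ (fun _ _ h => h)).seq fun τ₃ s₃ q₃ =>
    (Runs.flat (p := .copy 44 29) rfl (Q := fun τ => τ.reg 44 = (2 * d : ℕ)) ?_).seq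
      fun τ₄ s₄ q₄ =>
    (product_runs (L := 2 * d) (β := m) (b := fun _ => m) ?_ q₄ ?_ (fun _ _ => le_rfl)).seq
      fun τ₅ s₅ q₅ =>
    (Runs.flat (p := .copy 30 45 ;; .copy 44 0) rfl
      (Q := fun τ => τ.reg 30 = (m ^ (2 * d) : ℕ) ∧ τ.reg 44 = n) ?_).seq fun τ₆ s₆ q₆ =>
    (product_runs (L := n) (β := 2) (b := sideBase X) ?_ q₆.2 ?_ ?_).seq fun τ₇ s₇ q₇ =>
    Runs.flat (p := .copy 31 45) rfl ?_).le ?_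
  · intro j hj ρ hρ h12 h
    have e21 : ρ.reg 21 = m := by rw [hρ.1 21 rfl, s₁.1 21 rfl, h21]
    refine Runs.flat rfl fun i hi => ?_
    rcases Nat.lt_succ_iff_lt_or_eq.1 hi with hi | rfl
    · simp [Prog.run, h12, hi.ne, h i hi]
    · simp [Prog.run, h12, e21]
  · rw [s₂.1 0 rfl, s₁.1 0 rfl, h0]
  · rw [s₂.1 5 rfl, s₁.1 5 rfl, h5]
  · intro j hj ρ hρ h12 h
    have e5 : ρ.reg 5 = 1 := by rw [hρ.1 5 rfl, s₂.1 5 rfl, s₁.1 5 rfl, h5]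
    have e2 : ρ.arr 2 = σ.arr 2 := by rw [hρ.2 2 rfl, s₂.2 2 rfl, s₁.2 2 rfl]
    have hXj := hX j
    refine Runs.flat rfl fun i hi => ?_
    rcases Nat.lt_succ_iff_lt_or_eq.1 hi with hi | rfl
    · simp [Prog.run, h12, hi.ne, h i hi]
    · by_cases hh : i ∈ X <;> simp [Prog.run, h12, e5, e2, hXj, hh, sideBase]
  · simp [Prog.run, s₃.1 29 rfl, s₂.1 29 rfl, q₁]
  · rw [s₄.1 5 rfl, s₃.1 5 rfl, s₂.1 5 rfl, s₁.1 5 rfl, h5]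
  · rw [s₄.2 4 rfl, s₃.2 4 rfl]; exact q₂
  · simp [Prog.run, q₅, s₅.1 0 rfl, s₄.1 0 rfl, s₃.1 0 rfl, s₂.1 0 rfl, s₁.1 0 rfl, h0]
  · rw [s₆.1 5 rfl, s₅.1 5 rfl, s₄.1 5 rfl, s₃.1 5 rfl, s₂.1 5 rfl, s₁.1 5 rfl, h5]
  · rw [s₆.2 7 rfl, s₅.2 7 rfl, s₄.2 7 rfl]; exact q₃
  · intro i _
    unfold sideBase
    split_ifs <;> omega
  · refine ⟨?_, ?_, ?_, ?_, ?_⟩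
    · simp [Prog.run, s₇.1 29 rfl, s₆.1 29 rfl, s₅.1 29 rfl, s₄.1 29 rfl, s₃.1 29 rfl,
        s₂.1 29 rfl, q₁]
    · simp [Prog.run, s₇.1 30 rfl, q₆.1]
    · simp [Prog.run, q₇]
    · simp only [Prog.run, Store.arr_setReg, s₇.2 4 rfl, s₆.2 4 rfl, s₅.2 4 rfl, s₄.2 4 rfl,
        s₃.2 4 rfl]
      exact q₂
    · simp only [Prog.run, Store.arr_setReg, s₇.2 7 rfl, s₆.2 7 rfl, s₅.2 7 rfl, s₄.2 7 rfl]
      exact q₃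
  · apply le_of_eq; simp only [Prog.size]; ring

/-- Every cut that separates `s` from `t`, given by one of the first `P` side assignments, has
weight more than `a`. -/
def Safe (n : ℕ) (X : Finset ℕ) (w : ℕ → ℕ → ℤ) (a : ℤ) (s t P : ℕ) : Prop :=
  ∀ c < P, digit (sideBase X) c s < digit (sideBase X) c t →
    a < cutCost n w X (digit (sideBase X) c)

/-- The side assignment of number `46`, in array `8`, is tested. -/
def testCut : Prog :=
  .ite (.lt 36 37) (cost ;; .ite (.lt 4 50) .skip (.const 34 0)) .skip

/-- Register `34` becomes `1` or `0` according to whether all cuts are large. -/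
def testDefense : Prog :=
  .const 34 1 ;; forLoop 35 31 ((.copy 44 0 ;; .copy 46 35) ;; decode 7 8 ;;
    (.load 36 8 1 ;; .load 37 8 2) ;; testCut)

open Classical in
theorem testDefense_runs {σ : Store} {n s t P : ℕ} {a : ℤ} {X : Finset ℕ} {w : ℕ → ℕ → ℤ}
    (h0 : σ.reg 0 = n) (h1 : σ.reg 1 = s) (h2 : σ.reg 2 = t) (h4 : σ.reg 4 = a)
    (h5 : σ.reg 5 = 1) (h6 : σ.reg 6 = 0) (h31 : σ.reg 31 = P)
    (hM : ∀ i : ℕ, i < n → σ.arr 1 i = i * n) (hX : Represents (σ.arr 2) X)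
    (hw : ∀ u < n, ∀ v < n, σ.arr 6 (u * n + v) = w u v)
    (hb : ∀ i : ℕ, i < n → σ.arr 7 i = sideBase X i) (hs : s < n) (ht : t < n) :
    Runs testDefense σ (P * (n * (12 * n + 3 * P + 23) + 16) + 3) fun τ =>
      τ.reg 34 = if Safe n X w a s t P then 1 else 0 := by
  refine ((Runs.flat rfl (Q := fun τ => τ.reg 34 = 1) (by simp [Prog.run])).seq
    fun τ hτ h34 => Runs.forLoop (n := P)
      (T := 2 + ((n * (3 * P + 8) + 2) + (2 + (n * (12 * n + 15) + 3 + 3 + 1 + 1))))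
      (fun j τ => τ.reg 34 = if Safe n X w a s t j then 1 else 0) rfl
      ((hτ.1 31 rfl).trans h31) ((hτ.1 5 rfl).trans h5) (by simp [h34, Safe]) ?_
      (fun _ _ h => h)).le (by apply le_of_eq; simp only [Prog.size]; ring)
  intro c hc ρ hρ h35 h
  -- One frame statement for all registers that the test does not write; the default argument checks
  -- the Boolean at each use.
  have r {x : ℕ} (hx : testDefense.wr x = false := by rfl) : ρ.reg x = σ.reg x := by
    simp only [testDefense, Prog.wr, Bool.or_eq_false_iff] at hx
    rw [hρ.1 x hx.2, hτ.1 x hx.1]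
  have l {u : ℕ} (hu : testDefense.wa u = false := by rfl) : ρ.arr u = σ.arr u := by
    simp only [testDefense, Prog.wa, Bool.or_eq_false_iff] at hu
    rw [hρ.2 u hu.2, hτ.2 u rfl]
  refine (Runs.flat (p := .copy 44 0 ;; .copy 46 35) rfl
      (Q := fun τ => τ.reg 44 = n ∧ τ.reg 46 = c) (by simp [Prog.run, r (x := 0), h0, h35])).seq
      fun τ₁ s₁ q₁ =>
    ((decode_runs (L := n) (c := c) (b := sideBase X) (by decide) ?_ q₁.1 q₁.2 ?_ ?_).le ?_).seq
      fun τ₂ s₂ q₂ =>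
    (Runs.flat (p := .load 36 8 1 ;; .load 37 8 2) rfl
      (Q := fun τ => τ.reg 36 = digit (sideBase X) c s ∧ τ.reg 37 = digit (sideBase X) c t) ?_).seq
      fun τ₃ s₃ q₃ => ?_
  · rw [s₁.1 5 rfl, r, h5]
  · rw [s₁.2 7 rfl, l]; exact hb
  · intro i _
    unfold sideBase
    split_ifs <;> omega
  · gcongr
  · simp [Prog.run, s₂.1 1 rfl, s₁.1 1 rfl, r (x := 1), h1, s₂.1 2 rfl, s₁.1 2 rfl, r (x := 2), h2,
      q₂ s hs, q₂ t ht]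
  have r' {x : ℕ} (hx : testDefense.wr x = false := by rfl) : τ₃.reg x = σ.reg x := by
    rw [← r hx]
    simp only [testDefense, forLoop, Prog.wr, Bool.or_eq_false_iff] at hx
    rw [s₃.1 x (by simp [Prog.wr, hx]), s₂.1 x (by simp [hx]),
      s₁.1 x (by simp [Prog.wr, hx])]
  have l' {u : ℕ} (hu : testDefense.wa u = false := by rfl) : τ₃.arr u = σ.arr u := by
    rw [← l hu]
    simp only [testDefense, forLoop, Prog.wa, Bool.or_eq_false_iff] at hu
    rw [s₃.2 u (by simp [Prog.wa]), s₂.2 u (by simp [hu]),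
      s₁.2 u (by simp [Prog.wa])]
  have e34 : τ₃.reg 34 = if Safe n X w a s t c then 1 else 0 := by
    rw [s₃.1 34 rfl, s₂.1 34 rfl, s₁.1 34 rfl, h]
  have hsafe : Safe n X w a s t (c + 1) ↔ Safe n X w a s t c ∧
      (digit (sideBase X) c s < digit (sideBase X) c t →
        a < cutCost n w X (digit (sideBase X) c)) := Nat.forall_lt_succ_right
  refine (Runs.ite (T := n * (12 * n + 15) + 3 + Prog.size (.ite (.lt 4 50) .skip (.const 34 0)))
    (T' := Prog.size .skip) (fun hlt => ?_) fun hlt => ?_).le (by simp [Prog.size])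
  · simp only [Test.Holds, q₃, Nat.cast_lt] at hlt
    refine (cost_runs (n := n) (w := w) (X := X) (y := digit (sideBase X) c) ?_ ?_ ?_ ?_ ?_ ?_
      ?_).seq fun τ₄ s₄ q₄ => Runs.flat (p := .ite (.lt 4 50) .skip (.const 34 0)) rfl ?_
    · rw [r', h0]
    · rw [r', h5]
    · rw [r', h6]
    · rw [l']; exact hM
    · rw [l']; exact hX
    · rw [l']; exact hw
    · rw [s₃.2 8 rfl]; exact q₂
    · have e4 : τ₄.reg 4 = a := by rw [s₄.1 4 rfl, r', h4]
      have e34' := (s₄.1 34 rfl).trans e34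
      by_cases hh : a < cutCost n w X (digit (sideBase X) c) <;>
      simp [Prog.run, Test.Holds, e4, q₄, hh, e34', hlt, hsafe]
  · simp only [Test.Holds, q₃, Nat.cast_lt] at hlt
    exact Runs.flat rfl (by simp [Prog.run, e34, hlt, hsafe])

/-- Register `0` becomes `1` or `0` according to whether there is a defense for which all cuts are
large. -/
def search : Prog :=
  .const 32 0 ;; forLoop 33 30 ((.copy 44 29 ;; .copy 46 33) ;; decode 4 5 ;; setWeights ;;
    testDefense ;; .ite (.eq 34 5) (.const 32 1) .skip) ;; .copy 0 32

/-- One of the first `r` defenses is such that all cuts have weight more than `a`. -/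
def HasDefense (n : ℕ) (X : Finset ℕ) (E : ℕ → ℕ → Prop) (g : ℕ → ℕ) (m d : ℕ) (a : ℤ)
    (s t P r : ℕ) : Prop :=
  ∃ c < r, Safe n X (weight E (fun i => g (digit (fun _ => m) c i)) d a d) a s t P

open Classical in
theorem search_runs {σ : Store} {n s t d m P R : ℕ} {a : ℤ} {X : Finset ℕ} {E : ℕ → ℕ → Prop}
    {g : ℕ → ℕ} (h0 : σ.reg 0 = n) (h1 : σ.reg 1 = s) (h2 : σ.reg 2 = t) (h3 : σ.reg 3 = d)
    (h4 : σ.reg 4 = a) (h5 : σ.reg 5 = 1) (h6 : σ.reg 6 = 0) (h10 : σ.reg 10 = n * n)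
    (h29 : σ.reg 29 = (2 * d : ℕ)) (h30 : σ.reg 30 = R) (h31 : σ.reg 31 = P)
    (hM : ∀ i : ℕ, i < n → σ.arr 1 i = i * n) (hE : Adjacency (σ.arr 0) n E)
    (hsymm : ∀ u v, E u v → E v u) (hX : Represents (σ.arr 2) X)
    (hg : ∀ j : ℕ, j < m → g j < n ∧ σ.arr 3 j = g j)
    (hm : ∀ i : ℕ, i < 2 * d → σ.arr 4 i = m) (hm0 : 0 < m)
    (hb : ∀ i : ℕ, i < n → σ.arr 7 i = sideBase X i) (hs : s < n) (ht : t < n) :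
    Runs search σ (R * (2 * d * (3 * R + 16) + 4 * n * n +
      P * (n * (12 * n + 3 * P + 23) + 16) + 17) + 4) fun τ =>
      τ.reg 0 = if HasDefense n X E g m d a s t P R then 1 else 0 := by
  refine ((Runs.flat (p := .const 32 0) rfl (Q := fun τ => τ.reg 32 = 0) (by simp [Prog.run])).seq
    fun τ hτ h32 => (Runs.forLoop (n := R) (T := 2 + (2 * d * (3 * R + 8) + 2 +
        (4 * n * n + 16 * d + 5 + (P * (n * (12 * n + 3 * P + 23) + 16) + 3 + 3))))
      (fun j τ => τ.reg 32 = if HasDefense n X E g m d a s t P j then 1 else 0) rfl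
      ((hτ.1 30 rfl).trans h30) ((hτ.1 5 rfl).trans h5) (by simp [h32, HasDefense]) ?_
      (fun _ _ h => h)).seq fun ρ hρ h => Runs.flat (p := .copy 0 32) rfl
        (by simp [Prog.run, h])).le (by apply le_of_eq; simp only [Prog.size]; ring)
  intro c hc ρ hρ h33 h
  have r {x : ℕ} (hx : (testDefense.wr x || setWeights.wr x || (decode 4 5).wr x ||
      (x == 44 || x == 46 || x == 32 || x == 33)) = false := by rfl) :
      ρ.reg x = σ.reg x := by
    simp only [Bool.or_eq_false_iff] at hx
    rw [hρ.1 x (by simp [forLoop, Prog.wr, hx]), hτ.1 x (by simp [Prog.wr, hx])]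
  have l {u : ℕ} (hu : (testDefense.wa u || setWeights.wa u || (decode 4 5).wa u) = false
      := by rfl) : ρ.arr u = σ.arr u := by
    simp only [Bool.or_eq_false_iff] at hu
    rw [hρ.2 u (by simp [forLoop, Prog.wa, hu]), hτ.2 u (by simp [Prog.wa])]
  set p : ℕ → ℕ := fun i => g (digit (fun _ => m) c i) with hp
  refine (Runs.flat (p := .copy 44 29 ;; .copy 46 33) rfl
      (Q := fun τ => τ.reg 44 = (2 * d : ℕ) ∧ τ.reg 46 = c)
      (by simp [Prog.run, r (x := 29), h29, h33])).seq fun τ₁ s₁ q₁ =>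
    ((decode_runs (L := 2 * d) (c := c) (b := fun _ => m) (by decide) ?_ q₁.1 q₁.2 ?_
      (fun _ _ => hm0)).le ?_).seq fun τ₂ s₂ q₂ =>
    (setWeights_runs (n := n) (d := d) (a := a) (E := E) (p := p) ?_ ?_ ?_ ?_ ?_ ?_ hsymm ?_).seq
      fun τ₃ s₃ q₃ =>
    (testDefense_runs (n := n) (s := s) (t := t) (P := P) (a := a) (X := X) ?_ ?_ ?_ ?_ ?_ ?_ ?_
      ?_ ?_ q₃ ?_ hs ht).seq fun τ₄ s₄ q₄ =>
    Runs.flat (p := .ite (.eq 34 5) (.const 32 1) .skip) rfl ?_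
  · rw [s₁.1 5 rfl, r, h5]
  · rw [s₁.2 4 rfl, l]; exact hm
  · gcongr
  · rw [s₂.1 3 rfl, s₁.1 3 rfl, r, h3]
  · rw [s₂.1 4 rfl, s₁.1 4 rfl, r, h4]
  · rw [s₂.1 5 rfl, s₁.1 5 rfl, r, h5]
  · rw [s₂.1 10 rfl, s₁.1 10 rfl, r, h10]
  · rw [s₂.2 1 rfl, s₁.2 1 rfl, l]; exact hM
  · rw [s₂.2 0 rfl, s₁.2 0 rfl, l]; exact hE
  · intro i hi
    -- A digit is a remainder modulo `m`, hence a valid position in the list of kept vertices.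
    have := hg _ (Nat.mod_lt (quot (fun _ => m) c i) hm0)
    rw [s₂.2 3 rfl, s₁.2 3 rfl, l, q₂ i hi]
    exact this
  · rw [s₃.1 0 rfl, s₂.1 0 rfl, s₁.1 0 rfl, r, h0]
  · rw [s₃.1 1 rfl, s₂.1 1 rfl, s₁.1 1 rfl, r, h1]
  · rw [s₃.1 2 rfl, s₂.1 2 rfl, s₁.1 2 rfl, r, h2]
  · rw [s₃.1 4 rfl, s₂.1 4 rfl, s₁.1 4 rfl, r, h4]
  · rw [s₃.1 5 rfl, s₂.1 5 rfl, s₁.1 5 rfl, r, h5]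
  · rw [s₃.1 6 rfl, s₂.1 6 rfl, s₁.1 6 rfl, r, h6]
  · rw [s₃.1 31 rfl, s₂.1 31 rfl, s₁.1 31 rfl, r, h31]
  · rw [s₃.2 1 rfl, s₂.2 1 rfl, s₁.2 1 rfl, l]; exact hM
  · rw [s₃.2 2 rfl, s₂.2 2 rfl, s₁.2 2 rfl, l]; exact hX
  · rw [s₃.2 7 rfl, s₂.2 7 rfl, s₁.2 7 rfl, l]; exact hb
  · have e5 : τ₄.reg 5 = 1 := by rw [s₄.1 5 rfl, s₃.1 5 rfl, s₂.1 5 rfl, s₁.1 5 rfl, r, h5]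
    have e32 := h
    rw [← s₁.1 32 rfl, ← s₂.1 32 rfl, ← s₃.1 32 rfl, ← s₄.1 32 rfl] at e32
    have hex : HasDefense n X E g m d a s t P (c + 1) ↔ HasDefense n X E g m d a s t P c ∨
        Safe n X (weight E p d a d) a s t P := Nat.exists_lt_succ_right
    rw [hex]
    by_cases hh : Safe n X (weight E p d a d) a s t P <;>
    simp [Prog.run, Test.Holds, q₄, e5, hh, e32]

end RAM

namespace MCP

open Finset

/-! ### Cuts and sides -/

section Cuts

variable {V : Type*} {G : SimpleGraph V} {s t : V}

/-- All cuts that avoid `D` have more than `a` edges. -/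
def Resists (G : SimpleGraph V) (s t : V) (D : Finset (Sym2 V)) (a : ℤ) : Prop :=
  ∀ A : Finset (Sym2 V), IsCut G s t A → Disjoint A D → a < (A.card : ℤ)

theorem isCut_iff {A : Finset (Sym2 V)} : IsCut G s t A ↔
    (A : Set (Sym2 V)) ⊆ G.edgeSet ∧ ¬ (G.deleteEdges (A : Set (Sym2 V))).Reachable s t := by
  classical
  rw [IsCut, ← not_nonempty_iff]
  refine and_congr_right fun _ => not_congr ⟨fun ⟨p⟩ => p.1.reachable, fun ⟨p⟩ => ⟨p.toPath⟩⟩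

/-- Twins can be exchanged. -/
theorem adj_swap [DecidableEq V] {u v : V} (h : ∀ j, G.Adj u j ↔ G.Adj v j) (x y : V) :
    G.Adj (Equiv.swap u v x) (Equiv.swap u v y) ↔ G.Adj x y := by
  have key : ∀ x y, G.Adj (Equiv.swap u v x) y ↔ G.Adj x y := by
    intro x y
    by_cases hu : x = u
    · rw [hu, Equiv.swap_apply_left, h]
    · by_cases hv : x = v
      · rw [hv, Equiv.swap_apply_right, h]
      · rw [Equiv.swap_apply_of_ne_of_ne hu hv]
  rw [key, G.adj_comm, key, G.adj_comm]

variable [Fintype V]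

open Classical in
/-- The weight of the edges that lead from the side `f` to the other side: a defended edge has
weight `a + 1`, any other edge has weight `1`. -/
noncomputable def sideWeight (G : SimpleGraph V) (D : Finset (Sym2 V)) (a : ℤ) (f : V → Prop) : ℤ :=
  ∑ u, ∑ v, if f u ∧ ¬ f v ∧ G.Adj u v then if s(u, v) ∈ D then a + 1 else 1 else 0

open Classical in
/-- The edges that lead from the side `f` to the other side. -/
noncomputable def crossing (G : SimpleGraph V) (f : V → Prop) : Finset (V × V) :=
  univ.filter fun p => f p.1 ∧ ¬ f p.2 ∧ G.Adj p.1 p.2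

theorem mem_crossing {f : V → Prop} {p : V × V} :
    p ∈ crossing G f ↔ f p.1 ∧ ¬ f p.2 ∧ G.Adj p.1 p.2 := by
  simp [crossing]

/-- A crossing edge has only one orientation that leads from `f` to its complement, so ordered pairs
count edges correctly. -/
theorem injOn_crossing (f : V → Prop) :
    Set.InjOn (fun p : V × V => s(p.1, p.2)) (crossing G f : Set (V × V)) := by
  rintro ⟨u, v⟩ h ⟨u', v'⟩ h' he
  rw [mem_coe, mem_crossing] at h h'
  rcases Sym2.eq_iff.1 he with ⟨h1, h2⟩ | ⟨h1, h2⟩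
  · exact Prod.ext h1 h2
  · simp only at h1 h2 h h'
    subst h1 h2
    exact absurd h.1 h'.2.1

theorem sideWeight_eq (D : Finset (Sym2 V)) (a : ℤ) (f : V → Prop) [DecidableEq (Sym2 V)] :
    sideWeight G D a f = ∑ p ∈ crossing G f, if s(p.1, p.2) ∈ D then a + 1 else 1 := by
  classical
  rw [sideWeight, ← Fintype.sum_prod_type', crossing, Finset.sum_filter]
  refine Finset.sum_congr rfl fun p _ => ?_
  split_ifs <;> rfl

theorem sideWeight_eq_card {D : Finset (Sym2 V)} (a : ℤ) {f : V → Prop}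
    (h : ∀ p ∈ crossing G f, s(p.1, p.2) ∉ D) : sideWeight G D a f = (crossing G f).card := by
  classical
  rw [sideWeight_eq, Finset.sum_congr rfl fun p hp => if_neg (h p hp)]
  simp

/-- The edges crossing a bipartition form a cut; if one of them is defended, its weight alone
exceeds `a`, as all weights are nonnegative for `a ≥ 0`. Conversely, a cut that avoids `D` contains
all edges that cross the boundary of the component of `s`. -/
theorem resists_iff {D : Finset (Sym2 V)} {a : ℤ} (ha : 0 ≤ a) :
    Resists G s t D a ↔ ∀ f : V → Prop, ¬ f s → f t → a < sideWeight G D a f := by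
  classical
  constructor
  · intro hD f hs ht
    by_cases h : ∀ p ∈ crossing G f, s(p.1, p.2) ∉ D
    · rw [sideWeight_eq_card a h, ← Finset.card_image_of_injOn (injOn_crossing f)]
      refine hD _ (isCut_iff.2 ⟨?_, ?_⟩) ?_
      · intro e he
        simp only [coe_image, Set.mem_image, mem_coe, mem_crossing] at he
        obtain ⟨p, hp, rfl⟩ := he
        exact hp.2.2
      · rintro ⟨w⟩
        -- Traced backwards from `t`, a walk in the remaining graph can never leave the side `f`,
        -- because all crossing edges are deleted.
        suffices h : ∀ {x y : V} (w : (G.deleteEdges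
            (((crossing G f).image fun p : V × V => s(p.1, p.2) : Finset (Sym2 V)) :
              Set (Sym2 V))).Walk x y), f y → f x from hs (h w ht)
        intro x y w
        induction w with
        | nil => exact id
        | @cons u v _ hadj _ ih =>
          intro hy
          by_contra hu
          have hv := ih hy
          rw [SimpleGraph.deleteEdges_adj] at hadj
          refine hadj.2 ?_
          simp only [coe_image, Set.mem_image, mem_coe, mem_crossing]
          exact ⟨(v, u), ⟨hv, hu, hadj.1.symm⟩, Sym2.eq_swap⟩
      · rw [Finset.disjoint_left]
        intro e he
        obtain ⟨p, hp, rfl⟩ := Finset.mem_image.1 he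
        exact h p hp
    · push Not at h
      obtain ⟨p, hp, hpD⟩ := h
      rw [sideWeight_eq]
      have := Finset.single_le_sum (f := fun p : V × V => if s(p.1, p.2) ∈ D then a + 1 else 1)
        (fun q _ => by split_ifs <;> omega) hp
      simp only [hpD, if_true] at this
      omega
  · intro h A hA hAD
    rw [isCut_iff] at hA
    set f : V → Prop := fun v => ¬ (G.deleteEdges (A : Set (Sym2 V))).Reachable s v with hf
    have hcA : ∀ p ∈ crossing G f, s(p.1, p.2) ∈ A := by
      intro p hp
      rw [mem_crossing] at hp
      by_contra hpA
      refine hp.1 ((not_not.1 hp.2.1).trans (SimpleGraph.Adj.reachable ?_))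
      rw [SimpleGraph.deleteEdges_adj]
      exact ⟨hp.2.2.symm, by rwa [Sym2.eq_swap, mem_coe]⟩
    have := h f (fun hs => hs (SimpleGraph.Reachable.refl _)) hA.2
    rw [sideWeight_eq_card a fun p hp => Finset.disjoint_left.1 hAD (hcA p hp),
      ← Finset.card_image_of_injOn (injOn_crossing f)] at this
    refine this.trans_le (Nat.cast_le.2 (Finset.card_le_card fun e he => ?_))
    obtain ⟨p, hp, rfl⟩ := Finset.mem_image.1 he
    exact hcA p hp

/-! ### Twins -/

/-- The vertices that are incident to an edge of `D`. -/
noncomputable def touched (D : Finset (Sym2 V)) : Finset V := by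
  classical exact univ.filter fun v => ∃ e ∈ D, v ∈ e

theorem mem_touched {D : Finset (Sym2 V)} {v : V} : v ∈ touched D ↔ ∃ e ∈ D, v ∈ e := by
  simp [touched]

theorem card_touched_le (D : Finset (Sym2 V)) : (touched D).card ≤ 2 * D.card := by
  classical
  calc (touched D).card ≤ (D.biUnion fun e => e.toFinset).card := by
        refine Finset.card_le_card fun v hv => ?_
        obtain ⟨e, he, hv⟩ := mem_touched.1 hv
        exact Finset.mem_biUnion.2 ⟨e, he, Sym2.mem_toFinset.2 hv⟩
    _ ≤ D.card * 2 := Finset.card_biUnion_le_card_mul _ _ _ fun e _ => by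
        rw [Sym2.card_toFinset]; split_ifs <;> omega
    _ = 2 * D.card := mul_comm _ _

/-- An automorphism permutes the pairs of vertices, so moving the defense amounts to pulling back
the bipartition. -/
theorem sideWeight_image [DecidableEq (Sym2 V)] (e : Equiv.Perm V)
    (he : ∀ x y, G.Adj (e x) (e y) ↔ G.Adj x y) (D : Finset (Sym2 V)) (a : ℤ) (f : V → Prop) :
    sideWeight G (D.image (Sym2.map e)) a f = sideWeight G D a (f ∘ e) := by
  classical
  rw [sideWeight, ← Equiv.sum_comp e]
  refine Finset.sum_congr rfl fun x _ => ?_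
  rw [← Equiv.sum_comp e]
  refine Finset.sum_congr rfl fun y _ => ?_
  have hm : s(e x, e y) ∈ D.image (Sym2.map e) ↔ s(x, y) ∈ D := by
    rw [show s(e x, e y) = Sym2.map e s(x, y) from rfl]
    constructor
    · intro h
      obtain ⟨z, hz, hzz⟩ := Finset.mem_image.1 h
      rwa [← Sym2.map.injective e.injective hzz]
    · exact fun h => Finset.mem_image_of_mem _ h
  simp only [hm, he, Function.comp]
  split_ifs <;> rfl

end Cuts

open Classical in
/-- A defense can be moved to the vertices of which only few smaller vertices are twins. -/
theorem exists_touched_subset {n d : ℕ} {G : SimpleGraph (Fin n)} {s t : Fin n}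
    {D : Finset (Sym2 (Fin n))} {a : ℤ} (ha : 0 ≤ a) (hDG : (D : Set (Sym2 (Fin n))) ⊆ G.edgeSet)
    (hDd : D.card ≤ d) (hD : Resists G s t D a) :
    ∃ D' : Finset (Sym2 (Fin n)), (D' : Set (Sym2 (Fin n))) ⊆ G.edgeSet ∧ D'.card ≤ d ∧
      Resists G s t D' a ∧ ∀ v ∈ touched D', v = s ∨ v = t ∨
        (univ.filter fun u => u < v ∧ ∀ j, G.Adj u j ↔ G.Adj v j).card < 2 * d + 2 := by
  -- The sum of the touched indices decreases with each exchange of a touched vertex for a smaller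
  -- untouched twin.
  induction hμ : ∑ v ∈ touched D, (v : ℕ) using Nat.strong_induction_on generalizing D with
  | _ μ ih =>
    by_cases hall : ∀ v ∈ touched D, v = s ∨ v = t ∨
        (univ.filter fun u => u < v ∧ ∀ j, G.Adj u j ↔ G.Adj v j).card < 2 * d + 2
    · exact ⟨D, hDG, hDd, hD, hall⟩
    push Not at hall
    obtain ⟨v, hv, hvs, hvt, hcard⟩ := hall
    -- At most `2 * d - 1` touched vertices other than `v`, together with `s` and `t`, make at most
    -- `2 * d + 1` forbidden twins; hence the threshold `2 * d + 2`.
    have hlt : (insert s (insert t ((touched D).erase v))).card <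
        (univ.filter fun u => u < v ∧ ∀ j, G.Adj u j ↔ G.Adj v j).card := by
      have h1 := card_touched_le D
      have h2 := Finset.card_erase_of_mem hv
      have h3 := Finset.card_pos.2 ⟨v, hv⟩
      have h4 := Finset.card_insert_le s (insert t ((touched D).erase v))
      have h5 := Finset.card_insert_le t ((touched D).erase v)
      omega
    obtain ⟨u, hu, huD⟩ := Finset.exists_mem_notMem_of_card_lt_card hlt
    simp only [mem_filter, mem_univ, true_and] at hu
    simp only [mem_insert, mem_erase, not_or, not_and] at huD
    obtain ⟨hus, hut, huD⟩ := huD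
    have huD := huD hu.1.ne
    set e := Equiv.swap u v with he
    have hadj := adj_swap (G := G) hu.2
    have hes : e s = s := Equiv.swap_apply_of_ne_of_ne (Ne.symm hus) (Ne.symm hvs)
    have het : e t = t := Equiv.swap_apply_of_ne_of_ne (Ne.symm hut) (Ne.symm hvt)
    have htouch : touched (D.image (Sym2.map e)) = (touched D).image e := by
      ext x
      simp only [mem_touched, mem_image]
      constructor
      · rintro ⟨_, ⟨z, hz, rfl⟩, hx⟩
        obtain ⟨y, hy, rfl⟩ := Sym2.mem_map.1 hx
        exact ⟨y, ⟨z, hz, hy⟩, rfl⟩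
      · rintro ⟨y, ⟨z, hz, hy⟩, rfl⟩
        exact ⟨_, ⟨z, hz, rfl⟩, Sym2.mem_map.2 ⟨y, hy, rfl⟩⟩
    refine ih (∑ v ∈ touched (D.image (Sym2.map e)), (v : ℕ)) ?_ (D := D.image (Sym2.map e))
      ?_ (Finset.card_image_le.trans hDd) ?_ rfl
    · rw [← hμ, htouch, Finset.sum_image fun _ _ _ _ h => e.injective h]
      refine Finset.sum_lt_sum (fun x hx => ?_) ⟨v, hv, ?_⟩
      · by_cases hxv : x = v
        · rw [hxv, he, Equiv.swap_apply_right]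
          exact hu.1.le
        · have hxu : x ≠ u := fun h => huD (h ▸ hx)
          rw [he, Equiv.swap_apply_of_ne_of_ne hxu hxv]
      · rw [he, Equiv.swap_apply_right]
        exact hu.1
    · intro z hz
      obtain ⟨w, hw, rfl⟩ := Finset.mem_image.1 hz
      have := hDG hw
      induction w with
      | _ x y => exact (hadj x y).2 this
    · rw [resists_iff ha] at hD ⊢
      intro f hfs hft
      rw [sideWeight_image e hadj]
      exact hD _ (by simpa [hes] using hfs) (by simpa [het] using hft)

/-! ### Large budgets -/

section Budget

variable {V : Type*} {G : SimpleGraph V} {s t : V}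

/-- After each vertex outside `X` the walk has to return to `X`. The sharper second half, for walks
that start in `X`, is needed to carry the induction. -/
theorem support_count_le {X : Finset V} (hX : ∀ u v, G.Adj u v → u ∈ X ∨ v ∈ X) [DecidableEq V]
    {u v : V} (p : G.Walk u v) :
    p.support.countP (· ∉ X) ≤ p.support.countP (· ∈ X) + 1 ∧
      (u ∈ X → p.support.countP (· ∉ X) ≤ p.support.countP (· ∈ X)) := by
  induction p with
  | @nil u => by_cases h : u ∈ X <;> simp [h]
  | @cons u v w hadj p ih =>
    rw [SimpleGraph.Walk.support_cons, List.countP_cons, List.countP_cons]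
    by_cases hu : u ∈ X
    · simp only [hu, not_true, decide_true, decide_false, if_true, Bool.false_eq_true, if_false]
      omega
    · have := ih.2 ((hX u v hadj).resolve_left hu)
      simp only [hu, not_false_eq_true, decide_true, decide_false, if_true, Bool.false_eq_true,
        if_false, false_imp_iff, and_true]
      omega

/-- A path visits each vertex of `X` at most once, so it has at most `2 * |X|` vertices and one edge
fewer. -/
theorem length_lt_of_isPath {X : Finset V} (hX : ∀ u v, G.Adj u v → u ∈ X ∨ v ∈ X) (hs : s ∈ X)
    {p : G.Walk s t} (hp : p.IsPath) : p.length < 2 * X.card := by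
  classical
  have h1 := (support_count_le hX p).2 hs
  have h2 := List.length_eq_countP_add_countP (· ∈ X) (l := p.support)
  have h3 : p.support.countP (· ∈ X) ≤ X.card := by
    rw [List.countP_eq_length_filter, ← List.toFinset_card_of_nodup (hp.support_nodup.filter _)]
    refine Finset.card_le_card fun v hv => ?_
    simpa using (List.mem_filter.1 (List.mem_toFinset.1 hv)).2
  rw [SimpleGraph.Walk.length_support] at h2
  simp only [decide_eq_true_eq] at h2
  omega

/-- If a whole path is defended, no cut avoids the defense at all, whatever `a` is. If there is no
path, the empty cut defeats every defense. -/
theorem exists_resists_iff_reachable {d : ℤ} {a : ℤ} (ha : 0 ≤ a)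
    (hd : ∀ p : G.Walk s t, p.IsPath → (p.length : ℤ) ≤ d) :
    (∃ D : Finset (Sym2 V), (D : Set (Sym2 V)) ⊆ G.edgeSet ∧ (D.card : ℤ) ≤ d ∧
      Resists G s t D a) ↔ G.Reachable s t := by
  classical
  constructor
  · rintro ⟨D, -, -, hD⟩
    by_contra h
    have := hD ∅ (isCut_iff.2 ⟨by simp, by simpa using h⟩) (Finset.disjoint_empty_left _)
    simp only [card_empty, Nat.cast_zero] at this
    omega
  · rintro ⟨w⟩
    refine ⟨w.toPath.1.edges.toFinset, ?_, ?_, fun A hA hAD => ?_⟩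
    · intro e he
      exact w.toPath.1.edges_subset_edgeSet (by simpa using he)
    · refine le_trans (Nat.cast_le.2 (List.toFinset_card_le _)) ?_
      rw [SimpleGraph.Walk.length_edges]
      exact hd _ w.toPath.2
    · refine absurd ?_ (isCut_iff.1 hA).2
      refine ⟨w.toPath.1.toDeleteEdges _ fun e he heA => ?_⟩
      exact Finset.disjoint_left.1 hAD heA (List.mem_toFinset.2 he)

end Budget

end MCP

namespace RAM

open Finset

/-! ### Side assignments and cuts -/

/-- The weight that leads from the side where `f` is not `0` to the side where it is `0`. -/
def totalWeight (n : ℕ) (w : ℕ → ℕ → ℤ) (f : ℕ → ℕ) : ℤ :=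
  ∑ u ∈ range n, ∑ v ∈ range n, if f u ≠ 0 ∧ f v = 0 then w u v else 0

section Total

variable {n : ℕ} {w : ℕ → ℕ → ℤ} {X : Finset ℕ} {f : ℕ → ℕ}

/-- Each crossing edge is charged to one end: to its end on side `0` if the other end is in `X`, and
otherwise to its end on the nonzero side, which is then outside `X`. Thus a vertex outside `X` pays
for all its crossing edges, and these lead to `X`. -/
theorem totalWeight_eq (hw : ∀ u v, w u v = w v u)
    (hX : ∀ u < n, ∀ v < n, u ∉ X → v ∉ X → w u v = 0) :
    totalWeight n w f = ∑ v ∈ range n,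
      if f v = 0 then weightTo n w X (fun u => f u ≠ 0) v
      else if v ∈ X then 0 else weightTo n w X (fun u => f u = 0) v := by
  have h1 : totalWeight n w f = (∑ u ∈ range n, ∑ v ∈ range n,
      if f v = 0 then if u ∈ X ∧ f u ≠ 0 then w u v else 0 else 0) +
      ∑ u ∈ range n, ∑ v ∈ range n,
        if f u ≠ 0 ∧ u ∉ X then if v ∈ X ∧ f v = 0 then w v u else 0 else 0 := by
    rw [totalWeight, ← Finset.sum_add_distrib]
    refine Finset.sum_congr rfl fun u hu => ?_
    rw [← Finset.sum_add_distrib]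
    refine Finset.sum_congr rfl fun v hv => ?_
    rw [mem_range] at hu hv
    by_cases c1 : u ∈ X <;> by_cases c2 : v ∈ X <;> by_cases c3 : f u = 0 <;>
    by_cases c4 : f v = 0 <;> simp [c1, c2, c3, c4, hw u v]
    rw [hw]; exact hX u hu v hv c1 c2
  rw [h1, Finset.sum_comm, ← Finset.sum_add_distrib]
  refine Finset.sum_congr rfl fun v _ => ?_
  unfold weightTo
  by_cases c1 : f v = 0 <;> by_cases c2 : v ∈ X <;> simp [c1, c2]

theorem weightTo_congr {P Q : ℕ → Prop} [DecidablePred P] [DecidablePred Q]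
    (h : ∀ u < n, u ∈ X → (P u ↔ Q u)) (v : ℕ) : weightTo n w X P v = weightTo n w X Q v :=
  Finset.sum_congr rfl fun u hu => if_congr (and_congr_right fun hX => h u (mem_range.1 hu) hX)
    rfl rfl

/-- Term by term: outside `X` the minimum over both sides is at most the charge for the side that
`f` chooses. -/
theorem cutCost_le_totalWeight (hw : ∀ u v, w u v = w v u)
    (hX : ∀ u < n, ∀ v < n, u ∉ X → v ∉ X → w u v = 0) {y : ℕ → ℕ}
    (hy : ∀ v < n, v ∈ X → (y v = 0 ↔ f v = 0)) : cutCost n w X y ≤ totalWeight n w f := by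
  rw [totalWeight_eq hw hX, cutCost]
  have e0 (v) : weightTo n w X (fun u => y u ≠ 0) v = weightTo n w X (fun u => f u ≠ 0) v :=
    weightTo_congr (fun u hu h => not_congr (hy u hu h)) v
  have e1 (v) : weightTo n w X (fun u => y u = 0) v = weightTo n w X (fun u => f u = 0) v :=
    weightTo_congr hy v
  refine Finset.sum_le_sum fun v hv => ?_
  rw [share, e0, e1]
  by_cases c1 : v ∈ X
  · rw [if_pos c1, if_pos c1]
    exact (if_congr (hy v (mem_range.1 hv) c1) rfl rfl).le
  · rw [if_neg c1, if_neg c1]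
    split_ifs
    · exact min_le_left _ _
    · exact min_le_right _ _

/-- The bound is attained when every vertex outside `X` takes its cheaper side; these choices do not
interact, as they leave the sides on `X` unchanged. -/
theorem exists_totalWeight_eq_cutCost (hw : ∀ u v, w u v = w v u)
    (hX : ∀ u < n, ∀ v < n, u ∉ X → v ∉ X → w u v = 0) (y : ℕ → ℕ) :
    ∃ f : ℕ → ℕ, (∀ v ∈ X, f v = y v) ∧ totalWeight n w f = cutCost n w X y := by
  set f : ℕ → ℕ := fun v => if v ∈ X then y v else
    if weightTo n w X (fun u => y u ≠ 0) v ≤ weightTo n w X (fun u => y u = 0) v then 0 else 1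
    with hf
  have hfy : ∀ v ∈ X, f v = y v := fun v hv => by simp [hf, hv]
  refine ⟨f, hfy, ?_⟩
  rw [totalWeight_eq hw hX, cutCost]
  have e0 (v) : weightTo n w X (fun u => f u ≠ 0) v = weightTo n w X (fun u => y u ≠ 0) v :=
    weightTo_congr (fun u _ h => by rw [hfy u h]) v
  have e1 (v) : weightTo n w X (fun u => f u = 0) v = weightTo n w X (fun u => y u = 0) v :=
    weightTo_congr (fun u _ h => by rw [hfy u h]) v
  refine Finset.sum_congr rfl fun v _ => ?_
  rw [share, e0, e1]
  by_cases c1 : v ∈ X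
  · simp [c1, hfy v c1]
  · by_cases c2 : weightTo n w X (fun u => y u ≠ 0) v ≤ weightTo n w X (fun u => y u = 0) v
    · rw [min_eq_left c2, if_neg c1, if_neg c1, if_pos (by simp only [hf, if_neg c1, if_pos c2])]
    · rw [min_eq_right (le_of_not_ge c2), if_neg c1, if_neg c1,
        if_neg (by simp [hf, c1, if_neg c2])]

/-- Only the restriction of a bipartition to `X` has to be enumerated: `cutCost` is the least weight
over all its extensions. -/
theorem safe_iff (hw : ∀ u v, w u v = w v u)
    (hX : ∀ u < n, ∀ v < n, u ∉ X → v ∉ X → w u v = 0) {s t : ℕ} (hs : s < n) (ht : t < n)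
    (hsX : s ∈ X) (htX : t ∈ X) {a : ℤ} :
    Safe n X w a s t (∏ v ∈ range n, sideBase X v) ↔
      ∀ f : ℕ → ℕ, f s = 0 → f t ≠ 0 → a < totalWeight n w f := by
  constructor
  · intro h f hfs hft
    obtain ⟨c, hc, hd⟩ := exists_digit_eq n (sideBase X)
      (fun v => if v ∈ X ∧ f v ≠ 0 then 1 else 0) fun v _ => by
        unfold sideBase; by_cases c1 : v ∈ X <;> by_cases c2 : f v = 0 <;> simp [c1, c2]
    refine (h c hc ?_).trans_le (cutCost_le_totalWeight hw hX fun v hv hvX => ?_)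
    · rw [hd s hs, hd t ht]; simp [hfs, hft, htX]
    · rw [hd v hv]; simp [hvX]
  · intro h c _ hst
    obtain ⟨f, hf, he⟩ := exists_totalWeight_eq_cutCost hw hX (digit (sideBase X) c)
    rw [← he]
    -- With both digits below `2`, the strict inequality tested by the program means `0` for `s` and
    -- `1` for `t`.
    have h2 : digit (sideBase X) c t < 2 := by
      have := Nat.mod_lt (quot (sideBase X) c t) (y := sideBase X t) (by simp [sideBase, htX])
      simpa [digit, sideBase, htX] using this
    refine h f ?_ ?_
    · rw [hf s hsX]; omega
    · rw [hf t htX]; omega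

end Total

/-! ### Defenses encoded as sequences of kept vertices, and their number -/

theorem Defended.symm {p : ℕ → ℕ} {d j u v : ℕ} (h : Defended p d j u v) : Defended p d j v u := by
  obtain ⟨i, hi, h⟩ := h
  exact ⟨i, hi, by tauto⟩

theorem weight_comm {E : ℕ → ℕ → Prop} (hE : ∀ u v, E u v → E v u) (p : ℕ → ℕ) (d : ℕ) (a : ℤ)
    (j u v : ℕ) : weight E p d a j u v = weight E p d a j v u := by
  have h1 : E u v ↔ E v u := ⟨hE _ _, hE _ _⟩
  have h2 : Defended p d j u v ↔ Defended p d j v u := ⟨Defended.symm, Defended.symm⟩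
  unfold weight
  rw [h1, h2]

theorem weight_congr {E : ℕ → ℕ → Prop} {p p' : ℕ → ℕ} {d : ℕ} (h : ∀ i < 2 * d, p i = p' i)
    (a : ℤ) : weight E p d a d = weight E p' d a d := by
  have h2 (u v) : Defended p d d u v ↔ Defended p' d d u v :=
    exists_congr fun i => and_congr_right fun hi => by
      rw [h i (by omega), h (d + i) (by omega)]
  funext u v
  unfold weight
  rw [h2]

/-- The digits of a counter in base `|K|` are positions in the list `g` of `K`, and every sequence
of `2 * d` elements of `K` arises in this way. -/
theorem hasDefense_iff {n d s t : ℕ} {a : ℤ} {E : ℕ → ℕ → Prop} {X K : Finset ℕ} {g : ℕ → ℕ}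
    (hE : ∀ u v, E u v → E v u) (hX : Covers X n E) (hs : s < n) (ht : t < n) (hsX : s ∈ X)
    (htX : t ∈ X) (hg : ∀ j < K.card, g j ∈ K) (hg' : ∀ v ∈ K, ∃ j < K.card, g j = v)
    (hK : 0 < K.card) :
    HasDefense n X E g K.card d a s t (∏ v ∈ range n, sideBase X v) (K.card ^ (2 * d)) ↔
      ∃ p : ℕ → ℕ, (∀ i < 2 * d, p i ∈ K) ∧
        ∀ f : ℕ → ℕ, f s = 0 → f t ≠ 0 → a < totalWeight n (weight E p d a d) f := by
  have hw (p : ℕ → ℕ) : ∀ u < n, ∀ v < n, u ∉ X → v ∉ X → weight E p d a d u v = 0 := by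
    intro u hu v hv huX hvX
    have : ¬ E u v := fun h => (hX u hu v hv h).elim huX hvX
    simp [weight, this]
  constructor
  · rintro ⟨c, _, h⟩
    refine ⟨fun i => g (digit (fun _ => K.card) c i), fun i _ => hg _ (Nat.mod_lt _ hK), ?_⟩
    exact (safe_iff (weight_comm hE _ d a d) (hw _) hs ht hsX htX).1 h
  · rintro ⟨p, hp, h⟩
    choose! r hr hrp using hg'
    obtain ⟨c, hc, hd⟩ := exists_digit_eq (2 * d) (fun _ => K.card) (fun i => r (p i))
      fun i hi => hr _ (hp i hi)
    refine ⟨c, by simpa using hc, ?_⟩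
    rw [weight_congr (p' := p) fun i hi => by rw [hd i hi, hrp _ (hp i hi)]]
    exact (safe_iff (weight_comm hE _ d a d) (hw _) hs ht hsX htX).2 h

/-- There are few kept vertices. -/
theorem card_kept_le {n b : ℕ} {E : ℕ → ℕ → Prop} {X : Finset ℕ} (hX : Covers X n E) :
    (kept n E X b).card ≤ X.card + 2 ^ X.card * b := by
  classical
  -- A kept vertex outside `X` is determined by its neighborhood, a subset of `X`, and its rank
  -- among its twins, a number below `b`.
  have h1 : ((kept n E X b).filter (· ∉ X)).card ≤ (X.powerset ×ˢ range b).card := by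
    refine Finset.card_le_card_of_injOn (fun v => ((range n).filter (E v),
      ((range v).filter fun u => Twin n E u v).card)) ?_ ?_
    · intro v hv
      simp only [coe_filter, Set.mem_ofPred_eq, kept, mem_filter, mem_range] at hv
      obtain ⟨⟨hvn, hv⟩, hvX⟩ := hv
      simp only [coe_product, Set.mem_prod, mem_coe, mem_powerset, mem_range]
      refine ⟨fun j hj => ?_, hv.resolve_left hvX⟩
      simp only [mem_filter, mem_range] at hj
      exact (hX v hvn j hj.1 hj.2).resolve_left hvX
    -- The rank is strictly monotone within a twin class: `v` itself is counted for `v'` but not for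
    -- `v`.
    · have key : ∀ v v' : ℕ, v < v' → (range n).filter (E v) = (range n).filter (E v') →
          ((range v).filter fun u => Twin n E u v).card <
            ((range v').filter fun u => Twin n E u v').card := by
        intro v v' hlt he
        have htw : Twin n E v v' := fun j hj => by
          have := Finset.ext_iff.1 he j
          simpa [hj] using this
        refine Finset.card_lt_card ⟨fun u hu => ?_, fun hsub => ?_⟩
        · simp only [mem_filter, mem_range] at hu ⊢
          exact ⟨hu.1.trans hlt, fun j hj => (hu.2 j hj).trans (htw j hj)⟩
        · have := hsub (mem_filter.2 ⟨mem_range.2 hlt, htw⟩)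
          simp at this
      intro v _ v' _ he
      simp only [Prod.mk.injEq] at he
      rcases lt_trichotomy v v' with h | h | h
      · exact absurd he.2 (key v v' h he.1).ne
      · exact h
      · exact absurd he.2.symm (key v' v h he.1.symm).ne
  have h2 : ((kept n E X b).filter (· ∈ X)).card ≤ X.card :=
    Finset.card_le_card fun v hv => (mem_filter.1 hv).2
  rw [card_product, card_powerset, card_range] at h1
  have h3 := Finset.card_filter_add_card_filter_not (s := kept n E X b) (· ∈ X)
  omega

end RAM

namespace MCP

open Finset RAM

/-! ### Instances -/

/-- The edges of an instance, as a relation on the natural numbers. -/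
def Instance.edge (I : Instance) (u v : ℕ) : Prop :=
  ∃ (hu : u < I.n) (hv : v < I.n), I.G.Adj ⟨u, hu⟩ ⟨v, hv⟩

theorem Instance.edge_symm (I : Instance) (u v : ℕ) : I.edge u v → I.edge v u :=
  fun ⟨hu, hv, h⟩ => ⟨hv, hu, h.symm⟩

theorem Instance.edge_coe (I : Instance) (u v : Fin I.n) : I.edge u v ↔ I.G.Adj u v := by
  simp [edge]

theorem Instance.sideWeight_eq_totalWeight (I : Instance) {D : Finset (Sym2 (Fin I.n))}
    {p : ℕ → ℕ} {d : ℕ} {a : ℤ}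
    (hD : ∀ u v : Fin I.n, I.G.Adj u v → (s(u, v) ∈ D ↔ Defended p d d u v))
    {F : Fin I.n → Prop} {f : ℕ → ℕ} (hf : ∀ v : Fin I.n, F v ↔ f v ≠ 0) :
    sideWeight I.G D a F = totalWeight I.n (weight I.edge p d a d) f := by
  classical
  rw [totalWeight, Finset.sum_range, sideWeight]
  refine Finset.sum_congr rfl fun u _ => ?_
  rw [Finset.sum_range]
  refine Finset.sum_congr rfl fun v _ => ?_
  unfold weight
  by_cases h : I.G.Adj u v
  · have h' := (I.edge_coe u v).2 h
    have := hD u v h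
    by_cases c1 : f u = 0 <;> by_cases c2 : f v = 0 <;> by_cases c3 : Defended p d d u v <;>
    simp [h, h', hf, c1, c2, c3, this]
  · have h' := (I.edge_coe u v).not.2 h
    simp [h, h']

theorem Instance.resists_iff (I : Instance) {D : Finset (Sym2 (Fin I.n))}
    {p : ℕ → ℕ} {d : ℕ} {a : ℤ} (ha : 0 ≤ a)
    (hD : ∀ u v : Fin I.n, I.G.Adj u v → (s(u, v) ∈ D ↔ Defended p d d u v)) :
    Resists I.G I.s I.t D a ↔ ∀ f : ℕ → ℕ, f I.s = 0 → f I.t ≠ 0 →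
      a < totalWeight I.n (weight I.edge p d a d) f := by
  classical
  rw [MCP.resists_iff ha]
  constructor
  · intro h f hs ht
    rw [← I.sideWeight_eq_totalWeight hD (F := fun v => f v ≠ 0) fun _ => Iff.rfl]
    exact h _ (by simpa using hs) ht
  · intro h F hs ht
    set f : ℕ → ℕ := fun v => if ∃ hv : v < I.n, F ⟨v, hv⟩ then 1 else 0 with hfd
    have hf : ∀ v : Fin I.n, F v ↔ f v ≠ 0 := by simp [hfd]
    rw [I.sideWeight_eq_totalWeight hD hf]
    refine h _ ?_ ((hf _).1 ht)
    by_contra hc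
    exact hs ((hf _).2 hc)

/-- By the exchange of twins a defense may be taken with all its endpoints kept; `s` and `t`, exempt
from the exchange, are kept as elements of `X`. Conversely any sequence of pairs gives a defense,
after the pairs that are not edges are dropped. -/
theorem Instance.exists_resists_iff (I : Instance) {d : ℕ} {a : ℤ} (ha : 0 ≤ a) {X : Finset ℕ}
    (hs : (I.s : ℕ) ∈ X) (ht : (I.t : ℕ) ∈ X) :
    (∃ D : Finset (Sym2 (Fin I.n)), (D : Set (Sym2 (Fin I.n))) ⊆ I.G.edgeSet ∧ D.card ≤ d ∧
      Resists I.G I.s I.t D a) ↔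
    ∃ p : ℕ → ℕ, (∀ i < 2 * d, p i ∈ kept I.n I.edge X (2 * d + 2)) ∧
      ∀ f : ℕ → ℕ, f I.s = 0 → f I.t ≠ 0 →
        a < totalWeight I.n (weight I.edge p d a d) f := by
  classical
  constructor
  · rintro ⟨D₀, hG₀, hc₀, hD₀⟩
    obtain ⟨D, hG, hc, hD, htouch⟩ := exists_touched_subset ha hG₀ hc₀ hD₀
    have hsK : (I.s : ℕ) ∈ kept I.n I.edge X (2 * d + 2) := by simp [kept, hs]
    have hK : ∀ v ∈ touched D, (v : ℕ) ∈ kept I.n I.edge X (2 * d + 2) := by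
      intro v hv
      simp only [kept, mem_filter, mem_range, v.2, true_and]
      rcases htouch v hv with rfl | rfl | h
      · exact .inl hs
      · exact .inl ht
      · refine .inr (lt_of_le_of_lt ?_ h)
        rw [← Finset.card_map Fin.valEmbedding]
        refine Finset.card_le_card fun u hu => ?_
        simp only [mem_filter, mem_range] at hu
        refine mem_map.2 ⟨⟨u, hu.1.trans v.2⟩, ?_, rfl⟩
        simp only [mem_filter, mem_univ, true_and]
        exact ⟨hu.1, fun j => by simpa [← I.edge_coe] using hu.2 j j.2⟩
    have hl : D.toList.length ≤ d := by rwa [Finset.length_toList]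
    -- A defense with fewer than `d` edges is padded with the pair `(s, s)`, which is never an edge
    -- and whose entries are kept vertices.
    set q : ℕ → Fin I.n × Fin I.n := fun i =>
      if h : i < D.toList.length then Quot.out D.toList[i] else (I.s, I.s) with hq
    have hq1 : ∀ i, i < D.toList.length → s((q i).1, (q i).2) ∈ D := by
      intro i hi
      have : s((q i).1, (q i).2) = D.toList[i] := by
        simp only [hq, hi, dif_pos]
        exact Quot.out_eq _
      rw [this]
      exact Finset.mem_toList.1 (List.getElem_mem hi)
    have hqK : ∀ i, ((q i).1 : ℕ) ∈ kept I.n I.edge X (2 * d + 2) ∧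
        ((q i).2 : ℕ) ∈ kept I.n I.edge X (2 * d + 2) := by
      intro i
      by_cases hi : i < D.toList.length
      · have := hq1 i hi
        exact ⟨hK _ (mem_touched.2 ⟨_, this, by simp⟩), hK _ (mem_touched.2 ⟨_, this, by simp⟩)⟩
      · simp only [hq, hi, dif_neg, not_false_eq_true]
        exact ⟨hsK, hsK⟩
    -- The first half of the sequence holds the first endpoints, the second half the second
    -- endpoints.
    refine ⟨fun i => if i < d then (q i).1 else (q (i - d)).2, fun i _ => ?_, ?_⟩
    · dsimp only
      split_ifs
      · exact (hqK i).1
      · exact (hqK _).2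
    · refine (I.resists_iff ha fun u v huv => ?_).1 hD
      have hiff (i : ℕ) (hi : i < d) :
          (((u : ℕ) = (if i < d then ((q i).1 : ℕ) else (q (i - d)).2) ∧
            (v : ℕ) = (if d + i < d then ((q (d + i)).1 : ℕ) else (q (d + i - d)).2)) ∨
          ((u : ℕ) = (if d + i < d then ((q (d + i)).1 : ℕ) else (q (d + i - d)).2) ∧
            (v : ℕ) = (if i < d then ((q i).1 : ℕ) else (q (i - d)).2))) ↔
          s(u, v) = s((q i).1, (q i).2) := by
        rw [Sym2.eq_iff]
        simp [hi, Fin.ext_iff]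
      constructor
      · intro h
        obtain ⟨i, hi, he⟩ := List.getElem_of_mem (Finset.mem_toList.2 h)
        refine ⟨i, hi.trans_le hl, (hiff i (hi.trans_le hl)).2 ?_⟩
        rw [← he]
        simp only [hq, hi, dif_pos]
        exact (Quot.out_eq _).symm
      · rintro ⟨i, hi, h⟩
        rw [hiff i hi] at h
        by_cases hil : i < D.toList.length
        · rw [h]; exact hq1 i hil
        · exfalso
          simp only [hq, hil, dif_neg, not_false_eq_true] at h
          have h' : s(I.s, I.s) ∈ I.G.edgeSet := h ▸ huv
          exact I.G.loopless.irrefl _ h'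
  · rintro ⟨p, -, h⟩
    set D : Finset (Sym2 (Fin I.n)) := univ.filter fun e =>
      e ∈ I.G.edgeSet ∧ ∃ i < d, e.map Fin.val = s(p i, p (d + i)) with hD
    refine ⟨D, ?_, ?_, (I.resists_iff ha fun u v huv => ?_).2 h⟩
    · intro e he
      simp only [hD, coe_filter, mem_univ, true_and, Set.mem_ofPred_eq] at he
      exact he.1
    · rw [← Finset.card_image_of_injective D (Sym2.map.injective Fin.val_injective)]
      refine (Finset.card_le_card (t := (range d).image fun i => s(p i, p (d + i))) ?_).trans
        (Finset.card_image_le.trans (card_range d).le)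
      intro z hz
      obtain ⟨e, he, rfl⟩ := mem_image.1 hz
      simp only [hD, mem_filter, mem_univ, true_and] at he
      obtain ⟨-, i, hi, he⟩ := he
      exact mem_image.2 ⟨i, mem_range.2 hi, he.symm⟩
    · simp [hD, huv, Defended]

end MCP

namespace MCP

open Finset RAM

/-! ### The input memory, the reduction of large budgets and the complete program -/

theorem Instance.adjacency_input (I : Instance) : Adjacency (I.input.arr 0) I.n I.edge := by
  classical
  intro u hu v hv
  have key : (∃ i j : Fin I.n, I.G.Adj i j ∧
      (u : ℤ) * I.n + v = ((i : ℕ) : ℤ) * I.n + ((j : ℕ) : ℤ)) ↔ I.edge u v := by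
    constructor
    · rintro ⟨i, j, h, he⟩
      obtain ⟨rfl, rfl⟩ := (address_inj hv j.2).1 he
      exact (I.edge_coe i j).2 h
    · rintro ⟨hu, hv, h⟩
      exact ⟨_, _, h, rfl⟩
  by_cases h : I.edge u v
  · exact .inl ⟨if_pos ⟨rfl, key.2 h⟩, h⟩
  · exact .inr ⟨if_neg fun h' => h (key.1 h'.2), h⟩

theorem Instance.represents_input (I : Instance) : Represents (I.input.arr 2) ∅ := by
  intro v
  simp [input]

theorem Instance.exists_covers (I : Instance) :
    ∃ C : Finset ℕ, C.card = I.vc ∧ Covers C I.n I.edge := by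
  classical
  obtain ⟨c, hcard, hc⟩ := I.G.vertexCoverNum_exists
  have hcf : c.Finite := Set.toFinite c
  refine ⟨hcf.toFinset.map Fin.valEmbedding, ?_, fun u hu v hv h => ?_⟩
  · rw [card_map, vc, ← hcard, hcf.encard_eq_coe_toFinset_card, ENat.toNat_natCast]
  · obtain ⟨_, _, h⟩ := h
    rcases hc h with h | h
    · exact .inl (mem_map.2 ⟨⟨u, hu⟩, by simpa using h, rfl⟩)
    · exact .inr (mem_map.2 ⟨⟨v, hv⟩, by simpa using h, rfl⟩)

/-- Both sides say that `t` is reachable from `s`. For zero budgets the only defense is empty, and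
it resists exactly when the empty set is not a cut. -/
theorem Instance.isYes_iff_of_large (I : Instance) {X : Finset ℕ} (hX : Covers X I.n I.edge)
    (hs : (I.s : ℕ) ∈ X) (ha : 0 ≤ I.a) (hd : 2 * (X.card : ℤ) ≤ I.d) :
    I.IsYes ↔ ∃ D : Finset (Sym2 (Fin I.n)), (D : Set (Sym2 (Fin I.n))) ⊆ I.G.edgeSet ∧
      D.card ≤ 0 ∧ Resists I.G I.s I.t D 0 := by
  classical
  set Y : Finset (Fin I.n) := univ.filter fun v => (v : ℕ) ∈ X with hY
  have hYX : Y.card ≤ X.card := by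
    rw [← card_map Fin.valEmbedding]
    refine Finset.card_le_card fun v hv => ?_
    obtain ⟨w, hw, rfl⟩ := mem_map.1 hv
    exact (mem_filter.1 hw).2
  have hYc : ∀ u v, I.G.Adj u v → u ∈ Y ∨ v ∈ Y := fun u v h => by
    simpa [hY] using hX u u.2 v v.2 ((I.edge_coe u v).2 h)
  have h1 : I.IsYes ↔ I.G.Reachable I.s I.t := by
    refine exists_resists_iff_reachable (d := I.d) ha fun p hp => ?_
    have := length_lt_of_isPath hYc (by simpa [hY] using hs) hp
    omega
  rw [h1]
  constructor
  · intro h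
    refine ⟨∅, by simp, by simp, fun A hA _ => ?_⟩
    rcases A.eq_empty_or_nonempty with rfl | hne
    · exact absurd h (by simpa using (isCut_iff.1 hA).2)
    · exact_mod_cast hne.card_pos
  · rintro ⟨D, -, -, hD⟩
    by_contra h
    have := hD ∅ (isCut_iff.2 ⟨by simp, by simpa using h⟩) (Finset.disjoint_empty_left _)
    simp at this

/-- A large budget of the defender is replaced by `0`, and that of the attacker as well: all that
matters then is whether there is a path. -/
def clamp : Prog := .add 19 18 18 ;; .ite (.lt 3 19) .skip (.const 3 0 ;; .const 4 0)

/-- The decision of an instance with nonnegative budgets. -/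
def solve : Prog :=
  mulTable ;; cover ;; countCover ;; clamp ;; keep ;; setBases ;; search

/-- The number of steps of `solve`, for `n` vertices, a budget `d`, `m` kept vertices, `r`
defenses and `p` side assignments. -/
def steps (n d m r p : ℕ) : ℕ :=
  (4 * n + 3) + ((n * (13 * n + 5) + 4) + ((4 * n + 3) + (5 + ((n * (n * (9 * n + 8) + 13) + 6) +
    ((2 * d * (3 * m + 10) + 18 * n + 15) + (r * (2 * d * (3 * r + 16) + 4 * n * n +
      p * (n * (12 * n + 3 * p + 23) + 16) + 17) + 4))))))

theorem prod_sideBase {X : Finset ℕ} {n : ℕ} (hX : X ⊆ range n) :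
    ∏ v ∈ range n, sideBase X v = 2 ^ X.card := by
  unfold sideBase
  rw [Finset.prod_ite_mem, Finset.inter_eq_right.2 hX, prod_const]

/-- The quadratic exponent arises here: `m` is at most `2 ^ (5 * k)`, and `2 * d` such choices with
`d ≤ 2 * k` give `2 ^ (20 * k ^ 2)` sequences. -/
theorem card_bounds {x k d m N : ℕ} (hx : x ≤ k) (hx0 : 0 < x) (hd : d ≤ 2 * x)
    (hm : m ≤ x + 2 ^ x * (2 * d + 2)) (hN : 2 ^ (20 * k ^ 2) ≤ N) :
    m ≤ N ∧ m ^ (2 * d) ≤ N ∧ 2 ^ x ≤ N ∧ d ≤ N := by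
  have hle : ∀ i, i ≤ 20 * k ^ 2 → 2 ^ i ≤ N := fun i hi =>
    (Nat.pow_le_pow_right (by norm_num) hi).trans hN
  have hkk : k ≤ k ^ 2 := Nat.le_self_pow (by norm_num) k
  have hmk : m ≤ 2 ^ (5 * k) := by
    have h1 : x ≤ 2 ^ x := Nat.lt_two_pow_self.le
    calc m ≤ x + 2 ^ x * (2 * d + 2) := hm
      _ ≤ 2 ^ x + 2 ^ x * (2 * (2 * 2 ^ x) + 2) := by gcongr; omega
      _ ≤ 2 ^ (2 * x + 2) * 2 := by
        have : 1 ≤ 2 ^ x := Nat.one_le_two_pow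
        rw [pow_add, mul_comm 2 x, pow_mul]
        nlinarith
      _ = 2 ^ (2 * x + 3) := (pow_succ 2 (2 * x + 2)).symm
      _ ≤ 2 ^ (5 * k) := Nat.pow_le_pow_right (by norm_num) (by omega)
  refine ⟨hmk.trans (hle _ (by omega)), ?_, hle _ (by omega),
    (Nat.lt_two_pow_self (n := d)).le.trans (hle _ (by omega))⟩
  calc m ^ (2 * d) ≤ (2 ^ (5 * k)) ^ (2 * d) := Nat.pow_le_pow_left hmk _
    _ = 2 ^ (5 * k * (2 * d)) := (pow_mul _ _ _).symm
    _ ≤ N := hle _ (by nlinarith)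

open Classical in
-- A single number `N` bounds the vertices, the reduced budget, the kept vertices and both
-- enumerations, so the time is a polynomial in `N` alone.
theorem solve_runs (I : Instance) {σ : Store} {d N : ℕ} (h0 : σ.reg 0 = I.n)
    (h1 : σ.reg 1 = I.s) (h2 : σ.reg 2 = I.t) (h3 : σ.reg 3 = d) (hd : I.d = d)
    (h4 : σ.reg 4 = I.a) (ha : 0 ≤ I.a) (h5 : σ.reg 5 = 1) (h6 : σ.reg 6 = 0)
    (harr : σ.arr = I.input.arr) (hn : I.n ≤ N) (hN : 2 ^ (20 * (2 * I.vc + 2) ^ 2) ≤ N) :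
    Runs solve σ (steps N N N N N) fun τ => τ.reg 0 = if I.IsYes then 1 else 0 := by
  have hE : Adjacency (σ.arr 0) I.n I.edge := harr ▸ I.adjacency_input
  obtain ⟨C, hC, hCc⟩ := I.exists_covers
  refine ((mulTable_runs h0 h5).le (T' := 4 * N + 3) (by omega)).seq fun τ₁ s₁ q₁ =>
    ((cover_runs (n := I.n) (s := I.s) (t := I.t) (E := I.edge) ?_ ?_ ?_ ?_ ?_ q₁.2 ?_ ?_
      I.s.2 I.t.2).le (T' := N * (13 * N + 5) + 4) (by gcongr)).seq fun τ₂ s₂ q₂ => ?_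
  · rw [s₁.1 0 rfl, h0]
  · rw [s₁.1 1 rfl, h1]
  · rw [s₁.1 2 rfl, h2]
  · rw [s₁.1 5 rfl, h5]
  · rw [s₁.1 6 rfl, h6]
  · rw [s₁.2 0 rfl]; exact hE
  · rw [s₁.2 2 rfl, harr]; exact I.represents_input
  obtain ⟨X, hX, hXn, hXc, hsX, htX, hXC⟩ := q₂
  have hk : X.card ≤ 2 * I.vc + 2 := hC ▸ hXC C hCc
  refine ((countCover_runs (n := I.n) (X := X) ?_ ?_ hX hXn).le (T' := 4 * N + 3)
    (by omega)).seq fun τ₃ s₃ q₃ => ?_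
  · rw [s₂.1 0 rfl, s₁.1 0 rfl, h0]
  · rw [s₂.1 5 rfl, s₁.1 5 rfl, h5]
  have hk0 : 0 < X.card := Finset.card_pos.2 ⟨_, hsX⟩
  obtain ⟨d', a', hd', ha', hyes, hclamp⟩ : ∃ (d' : ℕ) (a' : ℤ), d' ≤ 2 * X.card ∧ 0 ≤ a' ∧
      (I.IsYes ↔ ∃ D : Finset (Sym2 (Fin I.n)), (D : Set (Sym2 (Fin I.n))) ⊆ I.G.edgeSet ∧
        D.card ≤ d' ∧ Resists I.G I.s I.t D a') ∧
      (clamp.run τ₃).reg 3 = d' ∧ (clamp.run τ₃).reg 4 = a' := by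
    have e3 : τ₃.reg 3 = d := by rw [s₃.1 3 rfl, s₂.1 3 rfl, s₁.1 3 rfl, h3]
    have e4 : τ₃.reg 4 = I.a := by rw [s₃.1 4 rfl, s₂.1 4 rfl, s₁.1 4 rfl, h4]
    by_cases hlt : (d : ℤ) < X.card + X.card
    · refine ⟨d, I.a, by omega, ha, ?_, ?_⟩
      · simp only [Instance.IsYes, Resists, hd, Nat.cast_le]
      · simp [clamp, Prog.run, Test.Holds, e3, e4, q₃, hlt]
    · refine ⟨0, 0, by omega, le_rfl, I.isYes_iff_of_large hXc hsX ha (by omega), ?_⟩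
      simp [clamp, Prog.run, Test.Holds, e3, q₃, hlt]
  set K := kept I.n I.edge X (2 * d' + 2) with hK
  have hsK : (I.s : ℕ) ∈ K := by simp [hK, kept, hsX]
  have hK0 : 0 < K.card := Finset.card_pos.2 ⟨_, hsK⟩
  obtain ⟨hmN, hRN, hPN, hdN⟩ := card_bounds hk hk0 hd' (card_kept_le hXc : K.card ≤ _) hN
  rw [← prod_sideBase hXn] at hPN
  refine (Runs.flat (p := clamp) rfl (Q := fun τ => τ.reg 3 = d' ∧ τ.reg 4 = a') hclamp).seq
    fun τ₄ s₄ q₄ =>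
    ((keep_runs (n := I.n) (d := d') (E := I.edge) (X := X) ?_ q₄.1 ?_ ?_ ?_ ?_).le
      (T' := N * (N * (9 * N + 8) + 13) + 6) (by gcongr)).seq fun τ₅ s₅ q₅ =>
    ((setBases_runs (n := I.n) (d := d') (m := K.card) (X := X) ?_ ?_ ?_ q₅.1 ?_).le
      (T' := 2 * N * (3 * N + 10) + 18 * N + 15) (by gcongr)).seq fun τ₆ s₆ q₆ => ?_
  · rw [s₄.1 0 rfl, s₃.1 0 rfl, s₂.1 0 rfl, s₁.1 0 rfl, h0]
  · rw [s₄.1 5 rfl, s₃.1 5 rfl, s₂.1 5 rfl, s₁.1 5 rfl, h5]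
  · rw [s₄.2 1 rfl, s₃.2 1 rfl, s₂.2 1 rfl]; exact q₁.2
  · rw [s₄.2 0 rfl, s₃.2 0 rfl, s₂.2 0 rfl, s₁.2 0 rfl]; exact hE
  · rw [s₄.2 2 rfl, s₃.2 2 rfl]; exact hX
  · rw [s₅.1 0 rfl, s₄.1 0 rfl, s₃.1 0 rfl, s₂.1 0 rfl, s₁.1 0 rfl, h0]
  · rw [s₅.1 3 rfl, q₄.1]
  · rw [s₅.1 5 rfl, s₄.1 5 rfl, s₃.1 5 rfl, s₂.1 5 rfl, s₁.1 5 rfl, h5]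
  · rw [s₅.2 2 rfl, s₄.2 2 rfl, s₃.2 2 rfl]; exact hX
  obtain ⟨hl, hl'⟩ := q₅.2
  choose! g hgK hg using hl
  have hg' : ∀ v ∈ K, ∃ j < K.card, g j = v := fun v hv => by
    obtain ⟨j, hj, he⟩ := hl' v hv
    exact ⟨j, hj, by rw [hg j hj] at he; exact_mod_cast he⟩
  obtain ⟨h29, h30, h31, hb4, hb7⟩ := q₆
  refine ((search_runs (n := I.n) (s := I.s) (t := I.t) (d := d') (m := K.card) (a := a') (X := X)
    (E := I.edge) (g := g) ?_ ?_ ?_ ?_ ?_ ?_ ?_ ?_ h29 h30 h31 ?_ ?_ I.edge_symm ?_ ?_ hb4 hK0 hb7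
    I.s.2 I.t.2)).mono ?_ ?_
  · rw [s₆.1 0 rfl, s₅.1 0 rfl, s₄.1 0 rfl, s₃.1 0 rfl, s₂.1 0 rfl, s₁.1 0 rfl, h0]
  · rw [s₆.1 1 rfl, s₅.1 1 rfl, s₄.1 1 rfl, s₃.1 1 rfl, s₂.1 1 rfl, s₁.1 1 rfl, h1]
  · rw [s₆.1 2 rfl, s₅.1 2 rfl, s₄.1 2 rfl, s₃.1 2 rfl, s₂.1 2 rfl, s₁.1 2 rfl, h2]
  · rw [s₆.1 3 rfl, s₅.1 3 rfl, q₄.1]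
  · rw [s₆.1 4 rfl, s₅.1 4 rfl, q₄.2]
  · rw [s₆.1 5 rfl, s₅.1 5 rfl, s₄.1 5 rfl, s₃.1 5 rfl, s₂.1 5 rfl, s₁.1 5 rfl, h5]
  · rw [s₆.1 6 rfl, s₅.1 6 rfl, s₄.1 6 rfl, s₃.1 6 rfl, s₂.1 6 rfl, s₁.1 6 rfl, h6]
  · rw [s₆.1 10 rfl, s₅.1 10 rfl, s₄.1 10 rfl, s₃.1 10 rfl, s₂.1 10 rfl, q₁.1]
  · rw [s₆.2 1 rfl, s₅.2 1 rfl, s₄.2 1 rfl, s₃.2 1 rfl, s₂.2 1 rfl]; exact q₁.2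
  · rw [s₆.2 0 rfl, s₅.2 0 rfl, s₄.2 0 rfl, s₃.2 0 rfl, s₂.2 0 rfl, s₁.2 0 rfl]; exact hE
  · rw [s₆.2 2 rfl, s₅.2 2 rfl, s₄.2 2 rfl, s₃.2 2 rfl]; exact hX
  · intro j hj
    rw [s₆.2 3 rfl]
    exact ⟨mem_range.1 (mem_filter.1 (hgK j hj)).1, hg j hj⟩
  · gcongr
  · intro τ _ h
    rw [h]
    refine if_congr ?_ rfl rfl
    rw [hyes, I.exists_resists_iff ha' hsX htX, hasDefense_iff I.edge_symm hXc I.s.2 I.t.2 hsX htX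
      hgK hg' hK0]

/-- The decision of all instances. -/
def program : Prog :=
  (.const 5 1 ;; .const 6 0) ;;
  .ite (.lt 3 6) (.const 0 0) (.ite (.lt 4 6) (.const 0 1) solve)

open Classical in
-- If `d < 0`, not even the empty defense is allowed; if `d ≥ 0 > a`, the empty defense suffices
-- since every cut has more than `a` edges.
theorem program_runs (I : Instance) {N : ℕ} (hn : I.n ≤ N)
    (hN : 2 ^ (20 * (2 * I.vc + 2) ^ 2) ≤ N) :
    Runs program I.input (steps N N N N N + 6) fun τ => τ.reg 0 = if I.IsYes then 1 else 0 := by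
  refine ((Runs.flat (p := .const 5 1 ;; .const 6 0) rfl
    (Q := fun τ => τ.reg 5 = 1 ∧ τ.reg 6 = 0) (by simp [Prog.run])).seq fun τ hτ ⟨h5, h6⟩ =>
    Runs.ite (T := 1) (T' := 1 + steps N N N N N + 1) (fun hlt => ?_) fun hlt => Runs.ite
      (fun hlt' => ?_) fun hlt' => ?_).le (by simp only [Prog.size]; omega)
  · simp only [Test.Holds, hτ.1 3 rfl, h6] at hlt
    have hlt : I.d < 0 := hlt
    refine Runs.flat (p := .const 0 0) rfl ?_
    have : ¬ I.IsYes := by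
      rintro ⟨D, -, hD, -⟩
      omega
    simp [Prog.run, this]
  · simp only [Test.Holds, hτ.1 3 rfl, hτ.1 4 rfl, h6] at hlt hlt'
    have hlt : ¬ I.d < 0 := hlt
    have hlt' : I.a < 0 := hlt'
    refine Runs.flat (p := .const 0 1) rfl ?_
    have : I.IsYes := ⟨∅, by simp, by simpa using hlt, fun A _ _ => by omega⟩
    simp [Prog.run, this]
  · simp only [Test.Holds, hτ.1 3 rfl, hτ.1 4 rfl, h6] at hlt hlt'
    have hlt : ¬ I.d < 0 := hlt
    have hlt' : ¬ I.a < 0 := hlt'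
    obtain ⟨d, hd⟩ := Int.eq_ofNat_of_zero_le (not_lt.1 hlt)
    exact solve_runs I (d := d) (hτ.1 0 rfl) (hτ.1 1 rfl) (hτ.1 2 rfl) ((hτ.1 3 rfl).trans hd) hd
      (hτ.1 4 rfl) (not_lt.1 hlt') h5 h6 (funext fun u => hτ.2 u rfl) hn hN

theorem steps_le (N : ℕ) (hN : 1 ≤ N) : steps N N N N N + 6 ≤ 2 ^ 9 * N ^ 4 := by
  have h1 : N ≤ N ^ 4 := Nat.le_self_pow (by norm_num) N
  have h2 : N ^ 2 ≤ N ^ 4 := Nat.pow_le_pow_right hN (by norm_num)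
  have h3 : N ^ 3 ≤ N ^ 4 := Nat.pow_le_pow_right hN (by norm_num)
  have h0 : 1 ≤ N ^ 4 := Nat.one_le_pow _ _ hN
  unfold steps
  ring_nf
  omega

end MCP

/-- One program decides Min (s,t)-Cut Prevention (the answer, `1` or `0`, is left in register `0`)
within `2 ^ (C * vc ^ 2) * n ^ C` steps, for one constant `C`. -/
theorem mainTheorem7 :
    ∃ (P : RAM.Prog) (C : ℕ), ∀ I : MCP.Instance, ∃ (τ : RAM.Store) (k : ℕ),
      RAM.Exec P I.input τ k ∧
      (I.IsYes → τ.reg 0 = 1) ∧ (¬ I.IsYes → τ.reg 0 = 0) ∧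
      k ≤ 2 ^ (C * I.vc ^ 2) * I.n ^ C := by
  classical
  refine ⟨MCP.program, 655, fun I => ?_⟩
  -- Since `n ≥ 2`, constant factors `2 ^ c` can be absorbed into `n ^ c`; this is essential when
  -- `vc = 0`.
  have hn : 2 ≤ I.n := by
    have h1 := I.s.2
    have h2 := I.t.2
    have h3 : (I.s : ℕ) ≠ I.t := fun h => I.s_ne_t (Fin.ext h)
    omega
  obtain ⟨e, he⟩ : ∃ e, e = 20 * (2 * I.vc + 2) ^ 2 := ⟨_, rfl⟩
  have hpos : 1 ≤ 2 ^ e := Nat.one_le_two_pow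
  obtain ⟨τ, k, hk, hkT, hτ⟩ := MCP.program_runs I (N := 2 ^ e * I.n)
    (Nat.le_mul_of_pos_left _ hpos) (he ▸ Nat.le_mul_of_pos_right _ (by omega))
  refine ⟨τ, k, hk, fun h => by simpa [h] using hτ, fun h => by simpa [h] using hτ, ?_⟩
  calc k ≤ 2 ^ 9 * (2 ^ e * I.n) ^ 4 :=
        hkT.trans (MCP.steps_le _ (Nat.mul_pos hpos (by omega)))
    _ = 2 ^ (9 + e * 4) * I.n ^ 4 := by rw [mul_pow, pow_add, pow_mul]; ring
    -- The exponent is `320 * vc ^ 2 + 640 * vc + 329`, and `2 * vc ≤ vc ^ 2 + 1` removes the linear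
    -- term. The constant `651` is chosen so that `651 + 4 = 655`.
    _ ≤ 2 ^ (655 * I.vc ^ 2 + 651) * I.n ^ 4 := by
        refine Nat.mul_le_mul_right _ (Nat.pow_le_pow_right (by norm_num) ?_)
        rcases Nat.eq_zero_or_pos I.vc with h | h
        · simp [he, h]
        · zify at *
          nlinarith [sq_nonneg ((I.vc : ℤ) - 1)]
    _ = 2 ^ (655 * I.vc ^ 2) * (2 ^ 651 * I.n ^ 4) := by rw [pow_add, mul_assoc]
    _ ≤ 2 ^ (655 * I.vc ^ 2) * (I.n ^ 651 * I.n ^ 4) := by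
        gcongr
    _ = 2 ^ (655 * I.vc ^ 2) * I.n ^ 655 := by rw [← pow_add]
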